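/- Let $N\ge 2$ and let $\mathcal G$ be a weighted digraph on $\{1,\dots,N\}$ with adjacency matrix $(a_{ij})$, $a_{ij}\ge 0$ (with $a_{ij}>0$ iff there is an edge from $j$ to $i$), which is strongly connected and weight-balanced ($\sum_j a_{ij}=\sum_j a_{ji}$ for all $i$). Let $L$ be its Laplacian, $L=\operatorname{diag}\big(\sum_j a_{ij}\big)_i-(a_{ij})$, and let $0=\lambda_1<\lambda_2\le\dots\le\lambda_N$ be the eigenvalues of $\tfrac12(L+L^\top)$. Let $f_1,\dots,f_N:\mathbb R\to\mathbb R$ be twice continuously differentiable with $\underline h_i\le f_i''(s)\le\bar h_i$ for all $s\in\mathbb R$, where $0<\underline h_i\le\bar h_i$; put $\underline h=\min_i\underline h_i$, $\bar h=\max_i\bar h_i$, and let $y^*$ be the minimizer of $\sum_{i=1}^N f_i$. Let $\eta>0$, $$\alpha\ge\max\Big\{1,\frac{2\eta}{\min\{\underline h,\lambda_2\}},\frac{6\bar h^2}{\underline h\lambda_2}\Big\},\qquad \beta\ge\max\Big\{1,\frac{7\alpha^2\lambda_N^2}{\lambda_2^2}\Big\},$$ and let $\tilde c_0,\tilde c_1\ge0$,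 $\tilde c_0+\tilde c_1>0$ and $0<\tilde\gamma<\min\{1,\tfrac{\eta}{2}\}$. Consider the event-triggered optimal signal generator $$\dot z_i=-\alpha f_i'(z_i)-\beta\sum_{j=1}^N a_{ij}(\tilde z_i-\tilde z_j)-\sum_{j=1}^N a_{ij}(\tilde v_i-\tilde v_j),\qquad \dot v_i=\alpha\beta\sum_{j=1}^N a_{ij}(\tilde z_i-\tilde z_j),\qquad i=1,\dots,N,$$ with sampled values $\tilde z_i(t)=z_i(\tilde t^i_k)$, $\tilde v_i(t)=v_i(\tilde t^i_k)$ for $t\in[\tilde t^i_k,\tilde t^i_{k+1})$, where $\tilde t^i_0=0$ and $$\tilde t^i_{k+1}=\inf\Big\{t>\tilde t^i_k\ \Big|\ \big\|\big(z_i(t)-z_i(\tilde t^i_k),\,v_i(t)-v_i(\tilde t^i_k)\big)\big\|\ge\tilde c_0+\tilde c_1e^{-\tilde\gamma t}\Big\},\qquad \inf\emptyset=+\infty .$$ Trajectories are considered on $[0,T)$ with $0<T\le\infty$ arbitrary (only $t<T$ enters the rule, and communication instants might a priori accumulate at $T$). Then the following hold. (i) For all initial values $z(0),v(0)$ there is $\tilde\tau_{\min}>0$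 such that every trajectory with these initial values satisfies $\tilde t^i_{k+1}-\tilde t^i_k>\tilde\tau_{\min}$ for all $i$ and all $k\ge0$ with $\tilde t^i_k<\infty$. (ii) Each $z_i$ converges exponentially into an interval centered at $y^*$ with radius proportional to $\tilde c_0$: there is a constant $\kappa>0$, independent of $\tilde c_0,\tilde c_1,\tilde\gamma$ and of the trajectory, and a rate $\mu>0$, independent of the trajectory, such that for all initial values $z(0),v(0)$ there is $C>0$ such that every trajectory with these initial values satisfies $$|z_i(t)-y^*|\le\kappa\,\tilde c_0+Ce^{-\mu t}\qquad\text{for all } i \text{ and all } t\in[0,T).$$ In particular, if $\tilde c_0=0$, then $z_i\to y^*$ exponentially along every trajectory with $T=\infty$. -/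

import Mathlib

namespace EventGenerator

/-- A weighted digraph on the nodes `0, …, N - 1`, given by its nonnegative adjacency matrix:
`adj i j > 0` if there is an edge from `j` to `i`, and `adj i j = 0` otherwise. -/
structure WeightedDigraph (N : ℕ) where
  /-- the weighted adjacency matrix -/
  adj : Matrix (Fin N) (Fin N) ℝ
  adj_nonneg : ∀ i j, 0 ≤ adj i j

namespace WeightedDigraph

variable {N : ℕ} (G : WeightedDigraph N)

/-- There is a directed edge from `u` to `w`. -/
def Edge (u w : Fin N) : Prop := 0 < G.adj w u

/-- Every node is reachable from every other node along directed edges. -/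
def StronglyConnected : Prop := ∀ u w : Fin N, Relation.ReflTransGen G.Edge u w

/-- At every node the total incoming weight equals the total outgoing weight. -/
def WeightBalanced : Prop := ∀ i : Fin N, ∑ j, G.adj i j = ∑ j, G.adj j i

/-- The Laplacian `L = D - A`, with `D` the diagonal matrix of the in-degrees. -/
def laplacian : Matrix (Fin N) (Fin N) ℝ :=
  Matrix.diagonal (fun i => ∑ j, G.adj i j) - G.adj

/-- `Sym(L) = (L + Lᵀ) / 2`. -/
noncomputable def symLaplacian : Matrix (Fin N) (Fin N) ℝ :=
  (2 : ℝ)⁻¹ • (G.laplacian + G.laplacian.transpose)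

theorem symLaplacian_isHermitian : G.symLaplacian.IsHermitian := by
  unfold symLaplacian Matrix.IsHermitian
  rw [Matrix.conjTranspose_eq_transpose_of_trivial, Matrix.transpose_smul,
    Matrix.transpose_add, Matrix.transpose_transpose, add_comm]

/-- The eigenvalues of `Sym(L)`, with multiplicity, in increasing order. Indices start at `0`, so
that `symEigenvalue ⟨k, _⟩` is `λ_{k+1}`. (Mathlib's `eigenvalues₀` is in decreasing order.) -/
noncomputable def symEigenvalue (k : Fin N) : ℝ :=
  G.symLaplacian_isHermitian.eigenvalues₀ (Fin.cast (Fintype.card_fin N).symm k.rev)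

/-- `λ₂`, the second smallest eigenvalue of `Sym(L)`. -/
noncomputable def lambdaTwo (hN : 2 ≤ N) : ℝ := G.symEigenvalue ⟨1, by omega⟩

/-- `λ_N`, the largest eigenvalue of `Sym(L)`. -/
noncomputable def lambdaMax (hN : 2 ≤ N) : ℝ := G.symEigenvalue ⟨N - 1, by omega⟩

end WeightedDigraph

/-- The communication instants of one agent with states `z`, `v` observed on `[0, T)`:
`t₀ = 0` and
`t_{k+1} = inf {s > t_k | ‖col (z s - z t_k, v s - v t_k)‖ ≥ c₀ + c₁ exp (-γ s)}`.
The infimum is taken in the extended reals: `t_{k+1} = ⊤` if no further event occurs on `[0, T)`,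
and `⊤` then stands for all later instants. -/
noncomputable def eventTime (c₀ c₁ γ : ℝ) (T : EReal) (z v : ℝ → ℝ) : ℕ → EReal
  | 0 => 0
  | k + 1 => sInf ((fun s : ℝ => (s : EReal)) '' {s : ℝ |
      eventTime c₀ c₁ γ T z v k < (s : EReal) ∧ (s : EReal) < T ∧
      c₀ + c₁ * Real.exp (-γ * s) ≤
        √((z s - z (eventTime c₀ c₁ γ T z v k).toReal) ^ 2 +
          (v s - v (eventTime c₀ c₁ γ T z v k).toReal) ^ 2)})

/-- `(z, v)`, with sampled values `(zs, vs)`, is a trajectory on `[0, T)`, `0 < T ≤ ⊤`, of the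
event-triggered generator
`zᵢ' = -α fᵢ'(zᵢ) - β ∑ⱼ aᵢⱼ (zsᵢ - zsⱼ) - ∑ⱼ aᵢⱼ (vsᵢ - vsⱼ)`,
`vᵢ' = α β ∑ⱼ aᵢⱼ (zsᵢ - zsⱼ)`.
The horizon `T` may be finite, and nothing is required at `T`; in particular communication instants
may accumulate there. They cannot accumulate earlier, since the sampled values, and hence the
right-hand side, are defined only as long as there is a most recent communication instant.
States are continuous. The right-hand side jumps at communication instants and is continuous from
the right, so the equations hold with right derivatives, at every instant of `[0, T)`. -/
structure IsTrajectory {N : ℕ} (G : WeightedDigraph N) (f : Fin N → ℝ → ℝ)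
    (α β c₀ c₁ γ : ℝ) (T : EReal) (z v zs vs : Fin N → ℝ → ℝ) : Prop where
  horizon_pos : 0 < T
  continuousOn_z : ∀ i, ContinuousOn (z i) {s : ℝ | 0 ≤ s ∧ (s : EReal) < T}
  continuousOn_v : ∀ i, ContinuousOn (v i) {s : ℝ | 0 ≤ s ∧ (s : EReal) < T}
  /-- at each instant of `[0, T)` there is a most recent communication instant of each agent, and
  the sampled values are the values of the states at that instant -/
  sampled : ∀ i, ∀ s : ℝ, 0 ≤ s → (s : EReal) < T → ∃ k : ℕ,
    eventTime c₀ c₁ γ T (z i) (v i) k ≤ (s : EReal) ∧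
    (s : EReal) < eventTime c₀ c₁ γ T (z i) (v i) (k + 1) ∧
    zs i s = z i (eventTime c₀ c₁ γ T (z i) (v i) k).toReal ∧
    vs i s = v i (eventTime c₀ c₁ γ T (z i) (v i) k).toReal
  deriv_z : ∀ i, ∀ s : ℝ, 0 ≤ s → (s : EReal) < T →
    HasDerivWithinAt (z i)
      (-α * deriv (f i) (z i s) - β * ∑ j, G.adj i j * (zs i s - zs j s)
        - ∑ j, G.adj i j * (vs i s - vs j s)) (Set.Ici s) s
  deriv_v : ∀ i, ∀ s : ℝ, 0 ≤ s → (s : EReal) < T →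
    HasDerivWithinAt (v i) (α * β * ∑ j, G.adj i j * (zs i s - zs j s)) (Set.Ici s) s

end EventGenerator

namespace EventGenerator

/-! ### The Laplacian of a weight-balanced digraph -/

namespace WeightedDigraph

open Matrix

variable {N : ℕ} {G : WeightedDigraph N}

/-! Write `L` for the Laplacian and `y*` for the minimizer. The numbers `fᵢ'(y*)` sum to zero, and
for a balanced, strongly connected digraph the range of `L` consists of all vectors of zero sum, so
some `w` solves `L w = -α f'(y*)`; then `(y*, w)` is an equilibrium. The error coordinates are `z -
y*` and `x`, the deviation from the mean of `v - w + α (z - y*)`. In `v' + α z'` the terms with `β`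
cancel, and the discarded mean is invisible to `L`, so nothing is lost and `x` lies where `L` has
the spectral gap `λ₂`.

With `V = (α³ |z - y*|² + |x|²) / 2`, strong monotonicity of `f'` and the gap supply damping, the
large `β` pays for the cross terms, and Young's inequality gives `V' ≤ -η V + K · (squared sampling
errors)` (`dissipation_scalar`, `AdmissibleGains.dissipation`). As `L` need not be symmetric, cross
terms are controlled by `|L u|² ≤ 2 λ_N (u ⬝ L u)`. The triggering rule keeps the sampling errors
below `c₀ + c₁ exp (-γ t)`; since `2 γ < η`, Gronwall yields `√(2V) ≤ κ c₀ + C exp (-γ t)`, which is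
the convergence claim with rate `γ`.

For the inter-event times, the speeds are bounded by a multiple of `√(2V)` plus the threshold, hence
by a multiple `D` of the threshold itself. The threshold loses less than a factor `3` per unit time,
so an error starting at zero needs a time of order `min 1 (1 / D)` to reach it. The argument is not
circular: the error bound follows from the rule alone, and no constant depends on the horizon `T`,
so accumulation at a finite `T` is excluded. -/

theorem laplacian_mulVec_apply (G : WeightedDigraph N) (x : Fin N → ℝ) (i : Fin N) :
    (G.laplacian *ᵥ x) i = ∑ j, G.adj i j * (x i - x j) := by
  rw [laplacian, sub_mulVec, Pi.sub_apply, mulVec_diagonal]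
  simp only [mulVec, dotProduct, mul_sub, Finset.sum_sub_distrib, Finset.sum_mul]

theorem laplacian_mulVec_const (G : WeightedDigraph N) (m : ℝ) :
    G.laplacian *ᵥ (fun _ => m) = 0 := by
  ext i
  simp [laplacian_mulVec_apply]

theorem laplacian_mulVec_sub_const (G : WeightedDigraph N) (x : Fin N → ℝ) (m : ℝ) :
    G.laplacian *ᵥ (fun i => x i - m) = G.laplacian *ᵥ x := by
  ext i
  simp [laplacian_mulVec_apply]

/-- The digraph with all edges reversed. -/
def reverse (G : WeightedDigraph N) : WeightedDigraph N where
  adj := G.adj.transpose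
  adj_nonneg i j := G.adj_nonneg j i

theorem WeightBalanced.reverse (h : G.WeightBalanced) : G.reverse.WeightBalanced :=
  fun i => (h i).symm

theorem WeightBalanced.laplacian_reverse (h : G.WeightBalanced) :
    G.reverse.laplacian = G.laplacian.transpose := by
  rw [laplacian, laplacian, transpose_sub, diagonal_transpose]
  congr 2
  ext i
  exact (h i).symm

theorem WeightBalanced.sum_laplacian_mulVec (h : G.WeightBalanced) (x : Fin N → ℝ) :
    ∑ i, (G.laplacian *ᵥ x) i = 0 := by
  simp only [laplacian_mulVec_apply, mul_sub, Finset.sum_sub_distrib]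
  rw [Finset.sum_comm (f := fun i j => G.adj i j * x j)]
  simp only [← Finset.sum_mul]
  simp [h _]

/-- By balance, `L` applied to the squares `x i ^ 2` has zero sum. Subtracting this sum uses `2 xᵢ
(xᵢ - xⱼ) - (xᵢ² - xⱼ²) = (xᵢ - xⱼ)²`. -/
theorem WeightBalanced.dotProduct_laplacian_mulVec_self (h : G.WeightBalanced)
    (x : Fin N → ℝ) :
    2 * (x ⬝ᵥ G.laplacian *ᵥ x) = ∑ i, ∑ j, G.adj i j * (x i - x j) ^ 2 := by
  have h1 := h.sum_laplacian_mulVec (fun i => x i ^ 2)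
  simp only [laplacian_mulVec_apply] at h1
  simp only [dotProduct, laplacian_mulVec_apply]
  rw [← sub_zero (2 * _), ← h1, Finset.mul_sum, ← Finset.sum_sub_distrib]
  refine Finset.sum_congr rfl fun i _ => ?_
  rw [Finset.mul_sum, Finset.mul_sum, ← Finset.sum_sub_distrib]
  refine Finset.sum_congr rfl fun j _ => ?_
  ring

theorem WeightBalanced.dotProduct_laplacian_mulVec_self_nonneg (h : G.WeightBalanced)
    (x : Fin N → ℝ) : 0 ≤ x ⬝ᵥ G.laplacian *ᵥ x := by
  have := h.dotProduct_laplacian_mulVec_self x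
  have : 0 ≤ ∑ i, ∑ j, G.adj i j * (x i - x j) ^ 2 :=
    Finset.sum_nonneg fun i _ => Finset.sum_nonneg fun j _ =>
      mul_nonneg (G.adj_nonneg i j) (sq_nonneg _)
  linarith

/-- Weighted Cauchy–Schwarz in each row, followed by summation over the rows. This replaces a
spectral bound, which is not directly available for a nonsymmetric `L`. -/
theorem WeightBalanced.normSq_laplacian_mulVec_le (h : G.WeightBalanced) {Λ : ℝ}
    (hΛ : ∀ i, G.laplacian i i ≤ Λ) (x : Fin N → ℝ) :
    ∑ i, (G.laplacian *ᵥ x) i ^ 2 ≤ 2 * Λ * (x ⬝ᵥ G.laplacian *ᵥ x) := by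
  have h2 := h.dotProduct_laplacian_mulVec_self x
  rw [show 2 * Λ * (x ⬝ᵥ G.laplacian *ᵥ x) = Λ * (2 * (x ⬝ᵥ G.laplacian *ᵥ x)) by ring, h2,
    Finset.mul_sum]
  refine Finset.sum_le_sum fun i _ => ?_
  have hcs := Finset.sum_sq_le_sum_mul_sum_of_sq_le_mul (Finset.univ.erase i)
    (r := fun j => G.adj i j * (x i - x j)) (f := fun j => G.adj i j)
    (g := fun j => G.adj i j * (x i - x j) ^ 2)
    (fun j _ => G.adj_nonneg i j)
    (fun j _ => mul_nonneg (G.adj_nonneg i j) (sq_nonneg _)) (fun j _ => le_of_eq (by ring))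
  -- A self-loop cancels in the diagonal entry of the Laplacian, so only the weights with `j ≠ i`
  -- are bounded by `Λ`.
  have h3 : ∑ j ∈ Finset.univ.erase i, G.adj i j ≤ Λ := by
    have := hΛ i
    rw [laplacian, Matrix.sub_apply, diagonal_apply_eq,
      ← Finset.add_sum_erase _ _ (Finset.mem_univ i)] at this
    linarith
  rw [Finset.sum_erase _ (by simp), Finset.sum_erase (f := fun j => G.adj i j * (x i - x j) ^ 2)
    _ (by simp)] at hcs
  rw [laplacian_mulVec_apply]
  exact hcs.trans (mul_le_mul_of_nonneg_right h3
    (Finset.sum_nonneg fun j _ => mul_nonneg (G.adj_nonneg i j) (sq_nonneg _)))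

/-- A Cauchy–Schwarz inequality between the norm and the Dirichlet form of the Laplacian. -/
theorem WeightBalanced.sq_dotProduct_laplacian_mulVec_le (h : G.WeightBalanced) {Λ : ℝ}
    (hΛ : ∀ i, G.laplacian i i ≤ Λ) (x y : Fin N → ℝ) :
    (x ⬝ᵥ G.laplacian *ᵥ y) ^ 2 ≤ 2 * Λ * (y ⬝ᵥ G.laplacian *ᵥ y) * ∑ i, x i ^ 2 := by
  have h1 := Finset.sum_mul_sq_le_sq_mul_sq Finset.univ x (G.laplacian *ᵥ y)
  have h2 := h.normSq_laplacian_mulVec_le hΛ y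
  have h3 : 0 ≤ ∑ i, x i ^ 2 := Finset.sum_nonneg fun i _ => sq_nonneg _
  calc _ ≤ _ := h1
    _ ≤ _ := by rw [mul_comm]; gcongr

/-- Reversing the edges transposes `L` and preserves its diagonal and its Dirichlet form. This moves
the Dirichlet form to the left factor. -/
theorem WeightBalanced.sq_dotProduct_laplacian_mulVec_le' (h : G.WeightBalanced) {Λ : ℝ}
    (hΛ : ∀ i, G.laplacian i i ≤ Λ) (x y : Fin N → ℝ) :
    (x ⬝ᵥ G.laplacian *ᵥ y) ^ 2 ≤ 2 * Λ * (x ⬝ᵥ G.laplacian *ᵥ x) * ∑ i, y i ^ 2 := by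
  have h1 := h.reverse.sq_dotProduct_laplacian_mulVec_le (Λ := Λ)
    (by rw [h.laplacian_reverse]; exact hΛ) y x
  have key : ∀ u w : Fin N → ℝ, u ⬝ᵥ G.laplacian.transpose *ᵥ w = w ⬝ᵥ G.laplacian *ᵥ u := by
    intro u w
    rw [mulVec_transpose, dotProduct_comm, ← dotProduct_mulVec]
  rwa [h.laplacian_reverse, key, key] at h1

theorem WeightBalanced.dotProduct_laplacian_mulVec_self_le (h : G.WeightBalanced) {Λ : ℝ}
    (hΛ : ∀ i, G.laplacian i i ≤ Λ) (hΛ0 : 0 ≤ Λ) (x : Fin N → ℝ) :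
    x ⬝ᵥ G.laplacian *ᵥ x ≤ 2 * Λ * ∑ i, x i ^ 2 := by
  have h1 := h.sq_dotProduct_laplacian_mulVec_le hΛ x x
  have h2 := h.dotProduct_laplacian_mulVec_self_nonneg x
  have h3 : 0 ≤ ∑ i, x i ^ 2 := Finset.sum_nonneg fun i _ => sq_nonneg _
  rcases h2.eq_or_lt with h0 | h0
  · rw [← h0]; positivity
  · refine le_of_mul_le_mul_right ?_ h0
    linarith

theorem WeightBalanced.sq_dotProduct_laplacian_mulVec_le_sq (h : G.WeightBalanced) {Λ : ℝ}
    (hΛ : ∀ i, G.laplacian i i ≤ Λ) (hΛ0 : 0 ≤ Λ) (x y : Fin N → ℝ) :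
    (x ⬝ᵥ G.laplacian *ᵥ y) ^ 2 ≤ 4 * Λ ^ 2 * (∑ i, x i ^ 2) * ∑ i, y i ^ 2 := by
  have h3 : 0 ≤ ∑ i, x i ^ 2 := Finset.sum_nonneg fun i _ => sq_nonneg _
  calc _ ≤ _ := h.sq_dotProduct_laplacian_mulVec_le hΛ x y
    _ ≤ 2 * Λ * (2 * Λ * ∑ i, y i ^ 2) * ∑ i, x i ^ 2 := by
      gcongr; exact h.dotProduct_laplacian_mulVec_self_le hΛ hΛ0 y
    _ = _ := by ring

/-- Every summand of the Dirichlet form vanishes, so `x` agrees across each edge, and then along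
directed paths. -/
theorem WeightBalanced.eq_of_dotProduct_laplacian_mulVec_self_nonpos (h : G.WeightBalanced)
    (hc : G.StronglyConnected) {x : Fin N → ℝ} (hx : x ⬝ᵥ G.laplacian *ᵥ x ≤ 0)
    (i j : Fin N) : x i = x j := by
  have h2 := h.dotProduct_laplacian_mulVec_self x
  have hnn : ∀ i j, 0 ≤ G.adj i j * (x i - x j) ^ 2 := fun i j =>
    mul_nonneg (G.adj_nonneg i j) (sq_nonneg _)
  have h0 : ∑ i, ∑ j, G.adj i j * (x i - x j) ^ 2 = 0 :=
    le_antisymm (by linarith) (Finset.sum_nonneg fun i _ => Finset.sum_nonneg fun j _ => hnn i j)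
  have hE : ∀ u w, G.Edge u w → x u = x w := by
    intro u w huw
    have h3 := (Finset.sum_eq_zero_iff_of_nonneg
      (fun i _ => Finset.sum_nonneg fun j _ => hnn i j)).1 h0 w (Finset.mem_univ w)
    have h4 := (Finset.sum_eq_zero_iff_of_nonneg (fun j _ => hnn w j)).1 h3 u (Finset.mem_univ u)
    rcases mul_eq_zero.1 h4 with h5 | h5
    · exact absurd h5 (ne_of_gt huw)
    · have := pow_eq_zero_iff (two_ne_zero) |>.1 h5
      linarith
  have := hc i j
  induction this with
  | refl => rfl
  | tail _ hbc ih => exact ih.trans (hE _ _ hbc)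

/-- The range of the Laplacian consists of the vectors with vanishing sum. -/
theorem WeightBalanced.exists_laplacian_mulVec_eq (h : G.WeightBalanced)
    (hc : G.StronglyConnected) (hN : 0 < N) {y : Fin N → ℝ} (hy : ∑ i, y i = 0) :
    ∃ w, G.laplacian *ᵥ w = y := by
  have hN' : (N : ℝ) ≠ 0 := by positivity
  -- Adding the all-ones matrix removes the kernel of `L`. On vectors of zero sum the added part
  -- vanishes, so inverting `T` solves the equation for `L`.
  let T : (Fin N → ℝ) →ₗ[ℝ] (Fin N → ℝ) :=
    G.laplacian.mulVecLin + LinearMap.pi fun _ => ∑ i, LinearMap.proj i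
  have hT : ∀ x, T x = G.laplacian *ᵥ x + fun _ => ∑ i, x i := by
    intro x
    ext i
    simp [T, LinearMap.sum_apply]
  have hsum : ∀ x, ∑ i, T x i = N * ∑ i, x i := by
    intro x
    rw [hT]
    simp [Finset.sum_add_distrib, h.sum_laplacian_mulVec]
  have hinj : Function.Injective T := by
    rw [← LinearMap.ker_eq_bot, LinearMap.ker_eq_bot']
    intro x hx
    have h1 := hsum x
    rw [hx] at h1
    have h2 : ∑ i, x i = 0 := by
      have : (N : ℝ) * ∑ i, x i = 0 := by rw [← h1]; simp
      exact (mul_eq_zero.1 this).resolve_left hN'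
    rw [hT, h2] at hx
    have h3 : G.laplacian *ᵥ x = 0 := by
      ext i
      simpa using congrFun hx i
    have h4 := h.eq_of_dotProduct_laplacian_mulVec_self_nonpos hc (x := x) (by simp [h3])
    ext i
    rw [Finset.sum_congr rfl fun j _ => h4 j i] at h2
    simpa [hN.ne'] using h2
  obtain ⟨w, hw⟩ := LinearMap.injective_iff_surjective.1 hinj y
  refine ⟨w, ?_⟩
  have h1 := hsum w
  rw [hw, hy] at h1
  have h2 : ∑ i, w i = 0 := (mul_eq_zero.1 h1.symm).resolve_left hN'
  rw [← hw, hT, h2]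
  ext i
  simp

/-! ### Spectral bounds -/

theorem dotProduct_symLaplacian_mulVec (G : WeightedDigraph N) (x : Fin N → ℝ) :
    x ⬝ᵥ G.symLaplacian *ᵥ x = x ⬝ᵥ G.laplacian *ᵥ x := by
  rw [symLaplacian, smul_mulVec, add_mulVec, dotProduct_smul, dotProduct_add,
    mulVec_transpose, dotProduct_comm x (x ᵥ* _), ← dotProduct_mulVec, smul_eq_mul]
  ring

theorem WeightBalanced.symLaplacian_mulVec_one (h : G.WeightBalanced) :
    G.symLaplacian *ᵥ (fun _ => 1) = 0 := by
  rw [symLaplacian, smul_mulVec, add_mulVec, ← h.laplacian_reverse, laplacian_mulVec_const,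
    laplacian_mulVec_const]
  simp

theorem dotProduct_eq_sum_eigenvectorBasis (G : WeightedDigraph N) (x y : Fin N → ℝ) :
    x ⬝ᵥ y = ∑ k, (⇑(G.symLaplacian_isHermitian.eigenvectorBasis k) ⬝ᵥ x) *
      (⇑(G.symLaplacian_isHermitian.eigenvectorBasis k) ⬝ᵥ y) := by
  have := G.symLaplacian_isHermitian.eigenvectorBasis.sum_inner_mul_inner
    (WithLp.toLp 2 x) (WithLp.toLp 2 y)
  simp only [EuclideanSpace.inner_eq_star_dotProduct, star_trivial] at this
  rw [dotProduct_comm, ← this]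
  refine Finset.sum_congr rfl fun k _ => ?_
  rw [dotProduct_comm y]

theorem eigenvectorBasis_dotProduct_mulVec (G : WeightedDigraph N) (k : Fin N) (y : Fin N → ℝ) :
    ⇑(G.symLaplacian_isHermitian.eigenvectorBasis k) ⬝ᵥ (G.symLaplacian *ᵥ y) =
      G.symLaplacian_isHermitian.eigenvalues k *
        (⇑(G.symLaplacian_isHermitian.eigenvectorBasis k) ⬝ᵥ y) := by
  have hS : G.symLaplacian.transpose = G.symLaplacian := by
    rw [← conjTranspose_eq_transpose_of_trivial]; exact G.symLaplacian_isHermitian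
  rw [dotProduct_mulVec, ← mulVec_transpose, hS,
    G.symLaplacian_isHermitian.mulVec_eigenvectorBasis, smul_dotProduct, smul_eq_mul]

theorem dotProduct_laplacian_mulVec_eq_sum (G : WeightedDigraph N) (x : Fin N → ℝ) :
    x ⬝ᵥ G.laplacian *ᵥ x = ∑ k, G.symLaplacian_isHermitian.eigenvalues k *
      (⇑(G.symLaplacian_isHermitian.eigenvectorBasis k) ⬝ᵥ x) ^ 2 := by
  rw [← dotProduct_symLaplacian_mulVec, dotProduct_eq_sum_eigenvectorBasis]
  refine Finset.sum_congr rfl fun k _ => ?_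
  rw [eigenvectorBasis_dotProduct_mulVec]
  ring

theorem sum_sq_eq_sum_eigenvectorBasis (G : WeightedDigraph N) (x : Fin N → ℝ) :
    ∑ i, x i ^ 2 =
      ∑ k, (⇑(G.symLaplacian_isHermitian.eigenvectorBasis k) ⬝ᵥ x) ^ 2 := by
  have := G.dotProduct_eq_sum_eigenvectorBasis x x
  simpa only [← pow_two, dotProduct] using this

theorem eigenvectorBasis_dotProduct_eigenvectorBasis (G : WeightedDigraph N) (k l : Fin N) :
    ⇑(G.symLaplacian_isHermitian.eigenvectorBasis k) ⬝ᵥ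
      ⇑(G.symLaplacian_isHermitian.eigenvectorBasis l) = if k = l then 1 else 0 := by
  have := orthonormal_iff_ite.1 G.symLaplacian_isHermitian.eigenvectorBasis.orthonormal l k
  simp only [EuclideanSpace.inner_eq_star_dotProduct, star_trivial] at this
  rw [this]
  simp [eq_comm]

theorem eigenvalues_le_lambdaMax (G : WeightedDigraph N) (hN : 2 ≤ N) (k : Fin N) :
    G.symLaplacian_isHermitian.eigenvalues k ≤ G.lambdaMax hN := by
  rw [lambdaMax, symEigenvalue, Matrix.IsHermitian.eigenvalues]
  apply G.symLaplacian_isHermitian.eigenvalues₀_antitone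
  rw [Fin.le_def]
  simp [Fin.rev]
  omega

theorem lambdaTwo_le_lambdaMax (G : WeightedDigraph N) (hN : 2 ≤ N) :
    G.lambdaTwo hN ≤ G.lambdaMax hN := by
  rw [lambdaMax, lambdaTwo, symEigenvalue, symEigenvalue]
  apply G.symLaplacian_isHermitian.eigenvalues₀_antitone
  rw [Fin.le_def]
  simp [Fin.rev]
  omega

/-- The family `eigenvalues` is `eigenvalues₀` reindexed by a bijection `σ`. Since `eigenvalues₀`
decreases, the smallest and second smallest values sit at the preimages of `N - 1` and `N - 2`. -/
theorem exists_lambdaTwo_le_eigenvalues (G : WeightedDigraph N) (hN : 2 ≤ N) :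
    ∃ m l : Fin N, l ≠ m ∧ G.symLaplacian_isHermitian.eigenvalues l = G.lambdaTwo hN ∧
      G.symLaplacian_isHermitian.eigenvalues m ≤ G.lambdaTwo hN ∧
      ∀ k ≠ m, G.lambdaTwo hN ≤ G.symLaplacian_isHermitian.eigenvalues k := by
  let σ : Fin N ≃ Fin (Fintype.card (Fin N)) :=
    (Fintype.equivOfCardEq (Fintype.card_fin (Fintype.card (Fin N)))).symm
  have hσ : ∀ k, G.symLaplacian_isHermitian.eigenvalues k =
    G.symLaplacian_isHermitian.eigenvalues₀ (σ k) := fun k => rfl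
  have hcard : Fintype.card (Fin N) = N := Fintype.card_fin N
  refine ⟨σ.symm ⟨N - 1, by omega⟩, σ.symm ⟨N - 2, by omega⟩, ?_, ?_, ?_, ?_⟩
  · rw [Ne, σ.symm.injective.eq_iff, Fin.mk.injEq]
    omega
  · rw [hσ, Equiv.apply_symm_apply, lambdaTwo, symEigenvalue]
    congr 1
  · rw [hσ, Equiv.apply_symm_apply, lambdaTwo, symEigenvalue]
    apply G.symLaplacian_isHermitian.eigenvalues₀_antitone
    rw [Fin.le_def]
    simp [Fin.rev]
    omega
  · intro k hk
    rw [hσ, lambdaTwo, symEigenvalue]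
    apply G.symLaplacian_isHermitian.eigenvalues₀_antitone
    rw [Fin.le_def]
    have h1 : σ k ≠ ⟨N - 1, by omega⟩ := fun h => hk (by rw [← h, Equiv.symm_apply_apply])
    have h2 : (σ k : ℕ) ≠ N - 1 := fun h => h1 (Fin.ext h)
    have h3 := (σ k).isLt
    simp [Fin.rev]
    omega

/-- Otherwise two orthonormal eigenvectors have nonpositive Dirichlet form, so both are constant;
but two nonzero constant vectors are not orthogonal. -/
theorem WeightBalanced.lambdaTwo_pos (h : G.WeightBalanced) (hc : G.StronglyConnected)
    (hN : 2 ≤ N) : 0 < G.lambdaTwo hN := by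
  obtain ⟨m, l, hlm, hl, hm, -⟩ := G.exists_lambdaTwo_le_eigenvalues hN
  by_contra hneg
  have hconst : ∀ k, G.symLaplacian_isHermitian.eigenvalues k ≤ 0 → ∀ i j,
      (G.symLaplacian_isHermitian.eigenvectorBasis k) i =
        (G.symLaplacian_isHermitian.eigenvectorBasis k) j := by
    intro k hk
    apply h.eq_of_dotProduct_laplacian_mulVec_self_nonpos hc
    rw [dotProduct_laplacian_mulVec_eq_sum]
    simpa [eigenvectorBasis_dotProduct_eigenvectorBasis] using hk
  have cl := hconst l (by linarith)
  have cm := hconst m (by linarith)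
  have i0 : Fin N := ⟨0, by omega⟩
  have e1 := G.eigenvectorBasis_dotProduct_eigenvectorBasis l l
  have e2 := G.eigenvectorBasis_dotProduct_eigenvectorBasis m m
  have e3 := G.eigenvectorBasis_dotProduct_eigenvectorBasis l m
  simp only [dotProduct, fun i => cl i i0, fun i => cm i i0, if_neg hlm, if_true,
    Finset.sum_const, Finset.card_univ, Fintype.card_fin, nsmul_eq_mul] at e1 e2 e3
  set a := (G.symLaplacian_isHermitian.eigenvectorBasis l) i0
  set b := (G.symLaplacian_isHermitian.eigenvectorBasis m) i0
  have : ((N : ℝ) * (a * b)) * (N * (a * b)) = 1 := by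
    calc _ = (N * (a * a)) * (N * (b * b)) := by ring
      _ = 1 := by rw [e1, e2, one_mul]
  rw [e3] at this
  norm_num at this

/-- The eigenvectors other than `b m` have positive eigenvalues, hence are orthogonal to the kernel
vector `1`. So `1` is a multiple of `b m`, and `x`, being orthogonal to `1`, has no component along
`b m`. -/
theorem WeightBalanced.lambdaTwo_mul_le (h : G.WeightBalanced) (hc : G.StronglyConnected)
    (hN : 2 ≤ N) {x : Fin N → ℝ} (hx : ∑ i, x i = 0) :
    G.lambdaTwo hN * ∑ i, x i ^ 2 ≤ x ⬝ᵥ G.laplacian *ᵥ x := by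
  obtain ⟨m, l, -, -, -, hk⟩ := G.exists_lambdaTwo_le_eigenvalues hN
  have hpos := h.lambdaTwo_pos hc hN
  let b : Fin N → Fin N → ℝ := fun k => ⇑(G.symLaplacian_isHermitian.eigenvectorBasis k)
  have hone : ∀ k ≠ m, b k ⬝ᵥ (fun _ => 1) = 0 := by
    intro k hkm
    have := G.eigenvectorBasis_dotProduct_mulVec k (fun _ => 1)
    rw [h.symLaplacian_mulVec_one, dotProduct_zero] at this
    exact (mul_eq_zero.1 this.symm).resolve_left (by linarith [hk k hkm])
  have hm : b m ⬝ᵥ x = 0 := by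
    have h1 := G.dotProduct_eq_sum_eigenvectorBasis (fun _ => 1) x
    have h2 := G.dotProduct_eq_sum_eigenvectorBasis (fun _ => 1) (fun _ => 1)
    rw [Finset.sum_eq_single m (fun k _ hkm => by rw [hone k hkm, zero_mul]) (by simp)] at h1 h2
    have h3 : (fun _ : Fin N => (1 : ℝ)) ⬝ᵥ x = 0 := by simpa [dotProduct] using hx
    have h4 : (fun _ : Fin N => (1 : ℝ)) ⬝ᵥ (fun _ => 1) = N := by simp [dotProduct]
    rw [h3] at h1
    rw [h4] at h2
    refine (mul_eq_zero.1 h1.symm).resolve_left fun h5 => ?_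
    rw [h5, zero_mul] at h2
    have : N = 0 := by exact_mod_cast h2
    omega
  rw [dotProduct_laplacian_mulVec_eq_sum, sum_sq_eq_sum_eigenvectorBasis, Finset.mul_sum]
  refine Finset.sum_le_sum fun k _ => ?_
  by_cases hkm : k = m
  · have : (⇑(G.symLaplacian_isHermitian.eigenvectorBasis k) ⬝ᵥ x) = 0 := by rw [hkm]; exact hm
    rw [this]
    simp
  · exact mul_le_mul_of_nonneg_right (hk k hkm) (sq_nonneg _)

/-- The Rayleigh quotient at a standard basis vector. -/
theorem laplacian_apply_self_le_lambdaMax (G : WeightedDigraph N) (hN : 2 ≤ N) (i : Fin N) :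
    G.laplacian i i ≤ G.lambdaMax hN := by
  have h1 := G.dotProduct_laplacian_mulVec_eq_sum (Pi.single i 1)
  have h2 := G.sum_sq_eq_sum_eigenvectorBasis (Pi.single i 1)
  have h3 : ∑ j, (Pi.single i 1 : Fin N → ℝ) j ^ 2 = 1 := by
    simp [Pi.single_apply]
  rw [single_one_dotProduct, mulVec_single_one, col_apply] at h1
  rw [h3] at h2
  have h4 : G.lambdaMax hN * 1 = ∑ k, G.lambdaMax hN *
      (⇑(G.symLaplacian_isHermitian.eigenvectorBasis k) ⬝ᵥ Pi.single i 1) ^ 2 := by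
    rw [← Finset.mul_sum, ← h2]
  rw [h1, ← mul_one (G.lambdaMax hN), h4]
  exact Finset.sum_le_sum fun k _ =>
    mul_le_mul_of_nonneg_right (G.eigenvalues_le_lambdaMax hN k) (sq_nonneg _)

end WeightedDigraph

end EventGenerator

/-! ### Young estimates for the dissipation, and a Gronwall inequality -/

namespace EventGenerator

theorem abs_le_add_of_sq_le_four_mul {a b c : ℝ} (ha : 0 ≤ a) (hb : 0 ≤ b)
    (h : c ^ 2 ≤ 4 * a * b) : |c| ≤ a + b :=
  abs_le_of_sq_le_sq (by nlinarith [sq_nonneg (a - b)]) (by positivity)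

/-- The scalar inequality behind the decay of the Lyapunov function. Here `Z` and `X` are squared
norms, `q` and `p` Dirichlet forms, `A`, `B₁`, `B₂`, `B₃` the remaining terms of the unperturbed
system, and `E₁`, `E₂`, `E₃` the terms caused by sampling. -/
theorem dissipation_scalar {α β η m h l Λ Z X q p A B₁ B₂ B₃ E₁ E₂ E₃ w₁ w₂ : ℝ}
    (hη : 0 < η) (hα1 : 1 ≤ α) (hm : 0 < m) (hl : 0 < l) (hlΛ : l ≤ Λ)
    (hαm : 2 * η ≤ α * m) (hαl : 2 * η ≤ α * l) (hαh : 6 * h ^ 2 ≤ α * (m * l))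
    (hβ : 7 * α ^ 2 * Λ ^ 2 ≤ β * l ^ 2)
    (hZ : 0 ≤ Z) (hX : 0 ≤ X) (hq : 0 ≤ q) (hp : l * X ≤ p) (hA : m * Z ≤ A)
    (hB₁ : B₁ ^ 2 ≤ 2 * Λ * q * X) (hB₂ : B₂ ^ 2 ≤ h ^ 2 * X * Z)
    (hB₃ : B₃ ^ 2 ≤ 2 * Λ * q * X)
    (hE₁ : E₁ ^ 2 ≤ 4 * Λ ^ 2 * Z * w₁) (hE₂ : E₂ ^ 2 ≤ 4 * Λ ^ 2 * Z * w₂)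
    (hE₃ : E₃ ^ 2 ≤ 4 * Λ ^ 2 * X * w₂) (hw₁ : 0 ≤ w₁) (hw₂ : 0 ≤ w₂) :
    α ^ 3 * (-(α * A) - (β - α) * q - B₁ - β * E₁ - E₂)
      + (-(α ^ 2 * B₂) - α * p + α ^ 2 * B₃ - α * E₃) ≤
      -η * ((α ^ 3 * Z + X) / 2) +
        (2 * α ^ 3 * β ^ 2 * Λ ^ 2 / η + 2 * α ^ 3 * Λ ^ 2 / η + 6 * α ^ 2 * Λ ^ 2 / η)
          * (w₁ + w₂) := by
  have hα0 : 0 < α := by linarith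
  have hΛ0 : 0 < Λ := by linarith
  have hl2 : 0 < l ^ 2 := by positivity
  -- One of the seven units in the bound for `β` absorbs the loss from `β` to `β - α`.
  have hβα : 6 * α ^ 2 * Λ ^ 2 ≤ (β - α) * l ^ 2 := by
    have h1 : l ^ 2 ≤ Λ ^ 2 := by gcongr
    have h2 : α * l ^ 2 ≤ α ^ 2 * Λ ^ 2 := by
      have : α * 1 ≤ α * α := by gcongr
      calc α * l ^ 2 ≤ α ^ 2 * l ^ 2 := by gcongr; nlinarith
        _ ≤ _ := by gcongr
    linarith
  have hβα0 : 0 < β - α := by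
    have : 0 < (β - α) * l ^ 2 := lt_of_lt_of_le (by positivity) hβα
    exact pos_of_mul_pos_left this hl2.le
  have b2 : |α ^ 2 * B₂| ≤ α * l / 3 * X + α ^ 4 * m / 8 * Z := by
    apply abs_le_add_of_sq_le_four_mul (by positivity) (by positivity)
    calc (α ^ 2 * B₂) ^ 2 = α ^ 4 * B₂ ^ 2 := by ring
      _ ≤ α ^ 4 * (h ^ 2 * X * Z) := by gcongr
      _ = α ^ 4 / 6 * X * Z * (6 * h ^ 2) := by ring
      _ ≤ α ^ 4 / 6 * X * Z * (α * (m * l)) := by gcongr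
      _ = _ := by ring
  have b13 : |α ^ 3 * B₁| + |α ^ 2 * B₃| ≤ α ^ 3 * (β - α) * q + α * l / 3 * X := by
    have key : ∀ B : ℝ, B ^ 2 ≤ 2 * Λ * q * X →
        |α ^ 3 * B| ≤ α ^ 3 * (β - α) / 2 * q + α * l / 6 * X := by
      intro B hB
      apply abs_le_add_of_sq_le_four_mul (by positivity) (by positivity)
      have h3 : 6 * α ^ 2 * Λ ≤ (β - α) * l := by
        have : 6 * α ^ 2 * Λ * Λ ≤ (β - α) * l * Λ := by
          calc 6 * α ^ 2 * Λ * Λ = 6 * α ^ 2 * Λ ^ 2 := by ring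
            _ ≤ (β - α) * l ^ 2 := hβα
            _ = (β - α) * l * l := by ring
            _ ≤ _ := by gcongr
        exact le_of_mul_le_mul_right this hΛ0
      calc (α ^ 3 * B) ^ 2 = α ^ 6 * B ^ 2 := by ring
        _ ≤ α ^ 6 * (2 * Λ * q * X) := by gcongr
        _ = α ^ 4 / 3 * q * X * (6 * α ^ 2 * Λ) := by ring
        _ ≤ α ^ 4 / 3 * q * X * ((β - α) * l) := by gcongr
        _ = _ := by ring
    have h1 := key _ hB₁
    have h2 := key _ hB₃
    have h3 : |α ^ 2 * B₃| ≤ |α ^ 3 * B₃| := by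
      rw [abs_mul, abs_mul, abs_of_pos (pow_pos hα0 2), abs_of_pos (pow_pos hα0 3)]
      have : α ^ 2 ≤ α ^ 3 := pow_le_pow_right₀ hα1 (by norm_num)
      gcongr
    linarith
  have e1 : |α ^ 3 * β * E₁| ≤ η * α ^ 3 / 2 * Z + 2 * α ^ 3 * β ^ 2 * Λ ^ 2 / η * w₁ := by
    apply abs_le_add_of_sq_le_four_mul (by positivity) (by positivity)
    calc (α ^ 3 * β * E₁) ^ 2 = α ^ 6 * β ^ 2 * E₁ ^ 2 := by ring
      _ ≤ α ^ 6 * β ^ 2 * (4 * Λ ^ 2 * Z * w₁) := by gcongr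
      _ = _ := by field_simp
  have e2 : |α ^ 3 * E₂| ≤ η * α ^ 3 / 2 * Z + 2 * α ^ 3 * Λ ^ 2 / η * w₂ := by
    apply abs_le_add_of_sq_le_four_mul (by positivity) (by positivity)
    calc (α ^ 3 * E₂) ^ 2 = α ^ 6 * E₂ ^ 2 := by ring
      _ ≤ α ^ 6 * (4 * Λ ^ 2 * Z * w₂) := by gcongr
      _ = _ := by field_simp
  have e3 : |α * E₃| ≤ η / 6 * X + 6 * α ^ 2 * Λ ^ 2 / η * w₂ := by
    apply abs_le_add_of_sq_le_four_mul (by positivity) (by positivity)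
    calc (α * E₃) ^ 2 = α ^ 2 * E₃ ^ 2 := by ring
      _ ≤ α ^ 2 * (4 * Λ ^ 2 * X * w₂) := by gcongr
      _ = _ := by field_simp
  have hAα : α ^ 4 * (m * Z) ≤ α ^ 4 * A := by gcongr
  have hpα : α * (l * X) ≤ α * p := by gcongr
  have hZm : 2 * η * (α ^ 3 * Z) ≤ α * m * (α ^ 3 * Z) := by gcongr
  have hXl : 2 * η * X ≤ α * l * X := by gcongr
  have g1 := neg_abs_le (α ^ 2 * B₂)
  have g2 := neg_abs_le (α ^ 3 * B₁)
  have g3 := le_abs_self (α ^ 2 * B₃)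
  have g4 := neg_abs_le (α ^ 3 * β * E₁)
  have g5 := neg_abs_le (α ^ 3 * E₂)
  have g6 := neg_abs_le (α * E₃)
  have c1 : 0 ≤ 2 * α ^ 3 * β ^ 2 * Λ ^ 2 / η * w₂ := by positivity
  have c2 : 0 ≤ 2 * α ^ 3 * Λ ^ 2 / η * w₁ := by positivity
  have c3 : 0 ≤ 6 * α ^ 2 * Λ ^ 2 / η * w₁ := by positivity
  have c4 : 0 ≤ η * (α ^ 3 * Z) := by positivity
  set K₁ := 2 * α ^ 3 * β ^ 2 * Λ ^ 2 / η
  set K₂ := 2 * α ^ 3 * Λ ^ 2 / η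
  set K₃ := 6 * α ^ 2 * Λ ^ 2 / η
  linarith

/-- A Gronwall inequality with an exponentially decaying inhomogeneity. -/
theorem le_of_hasDerivWithinAt_le_neg_mul_add {V V' : ℝ → ℝ} {η γ a b s : ℝ} (hη : 0 < η)
    (hγ : 2 * γ < η) (ha : 0 ≤ a) (hb : 0 ≤ b) (hs : 0 ≤ s)
    (hV : ContinuousOn V (Set.Icc 0 s))
    (hV' : ∀ t ∈ Set.Ico 0 s, HasDerivWithinAt V (V' t) (Set.Ici t) t)
    (hle : ∀ t ∈ Set.Ico 0 s, V' t ≤ -η * V t + a + b * Real.exp (-γ * t) ^ 2) :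
    V s ≤ V 0 * Real.exp (-η * s) + a / η + b / (η - 2 * γ) * Real.exp (-γ * s) ^ 2 := by
  have hsq : ∀ t, Real.exp (-γ * t) ^ 2 = Real.exp (-(2 * γ) * t) := by
    intro t
    rw [← Real.exp_nat_mul]
    congr 1
    push_cast
    ring
  have hδ : 0 < η - 2 * γ := by linarith
  have hexp : ∀ c t : ℝ, HasDerivAt (fun t => Real.exp (c * t)) (Real.exp (c * t) * c) t := by
    intro c t
    simpa using ((hasDerivAt_id t).const_mul c).exp
  -- Integrating factor `exp (η t)`, minus primitives of the two weighted inhomogeneities: the right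
  -- derivative of `g` is nonpositive. Right derivatives suffice, which matters because the dynamics
  -- jumps at communication instants.
  let g : ℝ → ℝ := fun t => Real.exp (η * t) * V t - a / η * Real.exp (η * t)
    - b / (η - 2 * γ) * Real.exp ((η - 2 * γ) * t)
  have hg : g s ≤ V 0 := by
    refine image_le_of_deriv_right_le_deriv_boundary (f := g) (B := fun _ => V 0) (B' := 0)
      (f' := fun t => Real.exp (η * t) * η * V t + Real.exp (η * t) * V' t
        - a / η * (Real.exp (η * t) * η)
        - b / (η - 2 * γ) * (Real.exp ((η - 2 * γ) * t) * (η - 2 * γ)))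
      ?_ ?_ ?_ continuousOn_const (fun t _ => hasDerivWithinAt_const _ _ _) ?_
      (Set.right_mem_Icc.2 hs)
    · fun_prop
    · intro t ht
      exact (((hexp η t).hasDerivWithinAt.mul (hV' t ht)).sub
        ((hexp η t).hasDerivWithinAt.const_mul _)).sub ((hexp _ t).hasDerivWithinAt.const_mul _)
    · have : 0 ≤ a / η := by positivity
      have : 0 ≤ b / (η - 2 * γ) := by positivity
      simp [g]
      linarith
    · intro t ht
      have h1 := hle t ht
      have h2 : Real.exp ((η - 2 * γ) * t) = Real.exp (η * t) * Real.exp (-γ * t) ^ 2 := by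
        rw [hsq, ← Real.exp_add]
        congr 1
        ring
      have h3 : a / η * (Real.exp (η * t) * η) = Real.exp (η * t) * a := by field_simp
      have h4 : b / (η - 2 * γ) * (Real.exp ((η - 2 * γ) * t) * (η - 2 * γ)) =
          Real.exp (η * t) * (b * Real.exp (-γ * t) ^ 2) := by
        rw [h2]; field_simp
      simp only [h3, h4, Pi.zero_apply]
      have := mul_le_mul_of_nonneg_left h1 (Real.exp_pos (η * t)).le
      linarith
  have h5 : Real.exp (-η * s) * Real.exp (η * s) = 1 := by
    rw [← Real.exp_add]; simp
  have h6 : Real.exp (-γ * s) ^ 2 = Real.exp (-η * s) * Real.exp ((η - 2 * γ) * s) := by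
    rw [hsq, ← Real.exp_add]
    congr 1
    ring
  have h7 := mul_le_mul_of_nonneg_left hg (Real.exp_pos (-η * s)).le
  have h8 : Real.exp (-η * s) * g s = V s - a / η - b / (η - 2 * γ) * Real.exp (-γ * s) ^ 2 := by
    rw [h6]
    calc _ = (Real.exp (-η * s) * Real.exp (η * s)) * V s
        - a / η * (Real.exp (-η * s) * Real.exp (η * s))
        - b / (η - 2 * γ) * (Real.exp (-η * s) * Real.exp ((η - 2 * γ) * s)) := by
          simp only [g]; ring
      _ = _ := by rw [h5]; ring
  linarith

/-! ### Event times -/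

section EventTime

variable {c₀ c₁ γ : ℝ} {T : EReal} {z v : ℝ → ℝ}

theorem eventTime_succ (k : ℕ) : eventTime c₀ c₁ γ T z v (k + 1) =
    sInf ((fun s : ℝ => (s : EReal)) '' {s : ℝ |
      eventTime c₀ c₁ γ T z v k < (s : EReal) ∧ (s : EReal) < T ∧
      c₀ + c₁ * Real.exp (-γ * s) ≤
        √((z s - z (eventTime c₀ c₁ γ T z v k).toReal) ^ 2 +
          (v s - v (eventTime c₀ c₁ γ T z v k).toReal) ^ 2)}) := rfl

/-- A finite infimum is taken over a nonempty set, any member of which bounds it strictly below `T`;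
the previous instant bounds it from below. Hence `toReal` loses nothing at finite instants. -/
theorem eventTime_eq_coe_of_ne_top (hT : 0 < T) (k : ℕ)
    (h : eventTime c₀ c₁ γ T z v k ≠ ⊤) :
    ∃ r : ℝ, 0 ≤ r ∧ (r : EReal) < T ∧ eventTime c₀ c₁ γ T z v k = (r : EReal) := by
  induction k with
  | zero => exact ⟨0, le_rfl, by simpa using hT, by simp [eventTime]⟩
  | succ k ih =>
    rw [eventTime_succ] at h ⊢
    set S := {s : ℝ | eventTime c₀ c₁ γ T z v k < (s : EReal) ∧ (s : EReal) < T ∧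
      c₀ + c₁ * Real.exp (-γ * s) ≤
        √((z s - z (eventTime c₀ c₁ γ T z v k).toReal) ^ 2 +
          (v s - v (eventTime c₀ c₁ γ T z v k).toReal) ^ 2)}
    rcases S.eq_empty_or_nonempty with hS | ⟨r, hr⟩
    · simp [hS] at h
    · have hk : eventTime c₀ c₁ γ T z v k ≠ ⊤ := fun h' => by
        have := hr.1
        rw [h'] at this
        exact absurd this not_top_lt
      obtain ⟨u, hu0, -, hu⟩ := ih hk
      have hlow : (0 : EReal) ≤ sInf ((fun s : ℝ => (s : EReal)) '' S) := by
        apply le_sInf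
        rintro _ ⟨x, hx, rfl⟩
        have h1 : (u : EReal) < x := hu ▸ hx.1
        have h2 : u < x := EReal.coe_lt_coe_iff.1 h1
        exact EReal.coe_nonneg.2 (hu0.trans h2.le)
      have hup : sInf ((fun s : ℝ => (s : EReal)) '' S) ≤ r := sInf_le ⟨r, hr, rfl⟩
      have hbot : sInf ((fun s : ℝ => (s : EReal)) '' S) ≠ ⊥ := fun h' => by
        rw [h'] at hlow
        exact absurd hlow (by simp)
      have hcoe := EReal.coe_toReal h hbot
      refine ⟨(sInf ((fun s : ℝ => (s : EReal)) '' S)).toReal, EReal.toReal_nonneg hlow, ?_,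
        hcoe.symm⟩
      rw [hcoe]
      exact hup.trans_lt hr.2.1

/-- Between communication instants the measurement error stays below the threshold. -/
theorem sqrt_error_le_of_lt_eventTime_succ {k : ℕ} {s : ℝ}
    (hc₀ : 0 ≤ c₀) (hc₁ : 0 ≤ c₁) (hs : (s : EReal) < T)
    (h₁ : eventTime c₀ c₁ γ T z v k ≤ s) (h₂ : (s : EReal) < eventTime c₀ c₁ γ T z v (k + 1)) :
    √((z s - z (eventTime c₀ c₁ γ T z v k).toReal) ^ 2 +
      (v s - v (eventTime c₀ c₁ γ T z v k).toReal) ^ 2) ≤ c₀ + c₁ * Real.exp (-γ * s) := by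
  rcases h₁.eq_or_lt with h | h
  · rw [h]
    simp
    positivity
  · by_contra! hcon
    refine absurd h₂ (not_lt.2 ?_)
    rw [eventTime_succ]
    exact sInf_le (Set.mem_image_of_mem _ ⟨h, hs, hcon.le⟩)

/-- A lower bound for inter-event times, when the states move at a rate bounded by a multiple of
the threshold. -/
theorem eventTime_add_lt_eventTime_succ (hT : 0 < T) (hc₀ : 0 ≤ c₀) (hc₁ : 0 ≤ c₁)
    (hc : 0 < c₀ + c₁) (hγ : 0 < γ) (hγ1 : γ < 1)
    (hz : ContinuousOn z {s : ℝ | 0 ≤ s ∧ (s : EReal) < T})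
    (hv : ContinuousOn v {s : ℝ | 0 ≤ s ∧ (s : EReal) < T}) {z' v' : ℝ → ℝ} {D : ℝ} (hD : 0 < D)
    (hz' : ∀ s : ℝ, 0 ≤ s → (s : EReal) < T → HasDerivWithinAt z (z' s) (Set.Ici s) s)
    (hv' : ∀ s : ℝ, 0 ≤ s → (s : EReal) < T → HasDerivWithinAt v (v' s) (Set.Ici s) s)
    (hzD : ∀ s : ℝ, 0 ≤ s → (s : EReal) < T → |z' s| ≤ D * (c₀ + c₁ * Real.exp (-γ * s)))
    (hvD : ∀ s : ℝ, 0 ≤ s → (s : EReal) < T → |v' s| ≤ D * (c₀ + c₁ * Real.exp (-γ * s)))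
    (k : ℕ) (hk : eventTime c₀ c₁ γ T z v k ≠ ⊤) :
    eventTime c₀ c₁ γ T z v k + ((min 1 (1 / (8 * D)) / 2 : ℝ) : EReal) <
      eventTime c₀ c₁ γ T z v (k + 1) := by
  obtain ⟨u, hu0, huT, hu⟩ := eventTime_eq_coe_of_ne_top hT k hk
  have hm : 0 < min 1 (1 / (8 * D)) := lt_min one_pos (by positivity)
  -- An event at `r` earlier than this is impossible: the change since `u` is at most `2 D (r - u) <
  -- 1/4` times the threshold at `u`, while the threshold at `r` is still at least a third of it.
  -- The halving in the statement makes the final inequality strict.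
  have key : ((u + min 1 (1 / (8 * D)) : ℝ) : EReal) ≤ eventTime c₀ c₁ γ T z v (k + 1) := by
    rw [eventTime_succ, hu]
    apply le_sInf
    rintro _ ⟨r, ⟨hur, hrT, hr⟩, rfl⟩
    rw [EReal.toReal_coe] at hr
    have hur' : u < r := EReal.coe_lt_coe_iff.1 hur
    refine EReal.coe_le_coe_iff.2 ?_
    by_contra! hcon
    have hr1 : r - u ≤ 1 := by have := min_le_left 1 (1 / (8 * D)); linarith
    have hr2 : r - u < 1 / (8 * D) := by have := min_le_right 1 (1 / (8 * D)); linarith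
    have hsub : Set.Icc u r ⊆ {s : ℝ | 0 ≤ s ∧ (s : EReal) < T} := fun x hx =>
      ⟨hu0.trans hx.1, lt_of_le_of_lt (EReal.coe_le_coe_iff.2 hx.2) hrT⟩
    have hsub' : ∀ x ∈ Set.Ico u r, 0 ≤ x ∧ (x : EReal) < T := fun x hx =>
      hsub (Set.Ico_subset_Icc_self hx)
    have hmono : ∀ x ∈ Set.Ico u r, D * (c₀ + c₁ * Real.exp (-γ * x)) ≤
        D * (c₀ + c₁ * Real.exp (-γ * u)) := by
      intro x hx
      have : -γ * x ≤ -γ * u := by nlinarith [hx.1]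
      gcongr
    have hbd : ∀ (y y' : ℝ → ℝ), ContinuousOn y {s : ℝ | 0 ≤ s ∧ (s : EReal) < T} →
        (∀ s : ℝ, 0 ≤ s → (s : EReal) < T → HasDerivWithinAt y (y' s) (Set.Ici s) s) →
        (∀ s : ℝ, 0 ≤ s → (s : EReal) < T → |y' s| ≤ D * (c₀ + c₁ * Real.exp (-γ * s))) →
        |y r - y u| ≤ D * (c₀ + c₁ * Real.exp (-γ * u)) * (r - u) := by
      intro y y' hy hy' hyD
      exact norm_image_sub_le_of_norm_deriv_right_le_segment (hy.mono hsub)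
        (fun x hx => hy' x (hsub' x hx).1 (hsub' x hx).2)
        (fun x hx => (hyD x (hsub' x hx).1 (hsub' x hx).2).trans (hmono x hx)) r
        (Set.right_mem_Icc.2 hur'.le)
    have h1 := hbd z z' hz hz' hzD
    have h2 := hbd v v' hv hv' hvD
    have h3 : √((z r - z u) ^ 2 + (v r - v u) ^ 2) ≤ |z r - z u| + |v r - v u| := by
      apply Real.sqrt_le_iff.2 ⟨by positivity, ?_⟩
      nlinarith [sq_abs (z r - z u), sq_abs (v r - v u), abs_nonneg (z r - z u),
        abs_nonneg (v r - v u), mul_nonneg (abs_nonneg (z r - z u)) (abs_nonneg (v r - v u))]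
    have h4 : c₀ + c₁ * Real.exp (-γ * u) ≤ 3 * (c₀ + c₁ * Real.exp (-γ * r)) := by
      have h5 : Real.exp (-γ * u) ≤ 3 * Real.exp (-γ * r) := by
        have h6 : Real.exp (-γ * u) = Real.exp (γ * (r - u)) * Real.exp (-γ * r) := by
          rw [← Real.exp_add]
          congr 1
          ring
        -- Here `γ < 1` and `r - u ≤ 1` enter; the factor `3` comes from `exp 1 < 3`.
        have h7 : Real.exp (γ * (r - u)) ≤ Real.exp 1 := by
          apply Real.exp_le_exp.2
          nlinarith
        rw [h6]
        gcongr
        linarith [Real.exp_one_lt_d9]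
      have := mul_le_mul_of_nonneg_left h5 hc₁
      linarith
    have hthr : 0 < c₀ + c₁ * Real.exp (-γ * u) := by
      rcases hc₀.eq_or_lt with h0 | h0
      · have : 0 < c₁ := by linarith
        positivity
      · positivity
    have h8 : D * (r - u) < 1 / 8 := by
      have := mul_lt_mul_of_pos_left hr2 hD
      have h9 : D * (1 / (8 * D)) = 1 / 8 := by field_simp
      linarith
    have h10 := mul_lt_mul_of_pos_right h8 hthr
    linarith
  refine lt_of_lt_of_le ?_ key
  rw [hu, ← EReal.coe_add]
  refine EReal.coe_lt_coe_iff.2 ?_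
  linarith

end EventTime

end EventGenerator

/-! ### The error system and its Lyapunov function -/

namespace EventGenerator

open Matrix

/-- The standing conditions on the digraph and the gains: `m` and `h` bound the second derivatives
of the costs, `l` bounds the Dirichlet form of the Laplacian from below, and `Λ` its diagonal
from above. -/
structure AdmissibleGains {N : ℕ} (G : WeightedDigraph N) (α β η m h l Λ : ℝ) : Prop where
  balanced : G.WeightBalanced
  eta_pos : 0 < η
  one_le_alpha : 1 ≤ α
  lower_pos : 0 < m
  upper_nonneg : 0 ≤ h
  gap_pos : 0 < l
  gap_le : l ≤ Λ
  two_eta_le_lower : 2 * η ≤ α * m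
  two_eta_le_gap : 2 * η ≤ α * l
  six_le : 6 * h ^ 2 ≤ α * (m * l)
  seven_le : 7 * α ^ 2 * Λ ^ 2 ≤ β * l ^ 2
  diagonal_le : ∀ i, G.laplacian i i ≤ Λ
  gap_mul_le : ∀ x : Fin N → ℝ, ∑ i, x i = 0 → l * ∑ i, x i ^ 2 ≤ x ⬝ᵥ G.laplacian *ᵥ x

/-- The gain from the measurement errors to the Lyapunov function. -/
noncomputable def perturbationGain (α β η Λ : ℝ) : ℝ :=
  2 * α ^ 3 * β ^ 2 * Λ ^ 2 / η + 2 * α ^ 3 * Λ ^ 2 / η + 6 * α ^ 2 * Λ ^ 2 / η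

variable {N : ℕ} {G : WeightedDigraph N} {α β η m h l Λ : ℝ}

theorem AdmissibleGains.alpha_pos (hg : AdmissibleGains G α β η m h l Λ) : 0 < α := by
  linarith [hg.one_le_alpha]

theorem AdmissibleGains.perturbationGain_pos (hg : AdmissibleGains G α β η m h l Λ) :
    0 < perturbationGain α β η Λ := by
  have h1 := hg.eta_pos
  have h2 := hg.alpha_pos
  have h3 : 0 < Λ := by linarith [hg.gap_pos, hg.gap_le]
  unfold perturbationGain
  positivity

/-- Decay of the Lyapunov function, as a statement about vectors. -/
theorem AdmissibleGains.dissipation (hg : AdmissibleGains G α β η m h l Λ)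
    {z x e d F : Fin N → ℝ} (hx : ∑ i, x i = 0)
    (hF : ∀ i, m * z i ^ 2 ≤ z i * F i) (hF' : ∀ i, |F i| ≤ h * |z i|) :
    α ^ 3 * (z ⬝ᵥ (-(α • F) - (β - α) • G.laplacian *ᵥ z - G.laplacian *ᵥ x
        - β • G.laplacian *ᵥ e - G.laplacian *ᵥ d))
      + x ⬝ᵥ (-(α ^ 2 • F) - α • G.laplacian *ᵥ x + α ^ 2 • G.laplacian *ᵥ z
        - α • G.laplacian *ᵥ d) ≤
      -η * ((α ^ 3 * ∑ i, z i ^ 2 + ∑ i, x i ^ 2) / 2) +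
        perturbationGain α β η Λ * (∑ i, e i ^ 2 + ∑ i, d i ^ 2) := by
  have hnn : ∀ y : Fin N → ℝ, 0 ≤ ∑ i, y i ^ 2 := fun y =>
    Finset.sum_nonneg fun i _ => sq_nonneg _
  have hΛ : 0 ≤ Λ := by linarith [hg.gap_pos, hg.gap_le]
  have hA : m * ∑ i, z i ^ 2 ≤ z ⬝ᵥ F := by
    rw [Finset.mul_sum]
    exact Finset.sum_le_sum fun i _ => hF i
  have hFsq : ∑ i, F i ^ 2 ≤ h ^ 2 * ∑ i, z i ^ 2 := by
    rw [Finset.mul_sum]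
    refine Finset.sum_le_sum fun i _ => ?_
    rw [← mul_pow, ← sq_abs (F i), ← sq_abs (h * z i), abs_mul, abs_of_nonneg hg.upper_nonneg]
    exact pow_le_pow_left₀ (abs_nonneg _) (hF' i) 2
  have hB₂ : (x ⬝ᵥ F) ^ 2 ≤ h ^ 2 * (∑ i, x i ^ 2) * ∑ i, z i ^ 2 :=
    calc (x ⬝ᵥ F) ^ 2 ≤ (∑ i, x i ^ 2) * ∑ i, F i ^ 2 :=
          Finset.sum_mul_sq_le_sq_mul_sq Finset.univ x F
      _ ≤ (∑ i, x i ^ 2) * (h ^ 2 * ∑ i, z i ^ 2) := mul_le_mul_of_nonneg_left hFsq (hnn x)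
      _ = _ := by ring
  -- Both cross terms `z ⬝ L x` and `x ⬝ L z` are charged to the Dirichlet form of `z`, whose
  -- damping carries the large factor `β - α`. The first therefore needs the transposed inequality.
  have key := dissipation_scalar hg.eta_pos hg.one_le_alpha hg.lower_pos hg.gap_pos hg.gap_le
    hg.two_eta_le_lower hg.two_eta_le_gap hg.six_le hg.seven_le (hnn z) (hnn x)
    (hg.balanced.dotProduct_laplacian_mulVec_self_nonneg z) (hg.gap_mul_le x hx) hA
    (hg.balanced.sq_dotProduct_laplacian_mulVec_le' hg.diagonal_le z x) hB₂
    (hg.balanced.sq_dotProduct_laplacian_mulVec_le hg.diagonal_le x z)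
    (hg.balanced.sq_dotProduct_laplacian_mulVec_le_sq hg.diagonal_le hΛ z e)
    (hg.balanced.sq_dotProduct_laplacian_mulVec_le_sq hg.diagonal_le hΛ z d)
    (hg.balanced.sq_dotProduct_laplacian_mulVec_le_sq hg.diagonal_le hΛ x d) (hnn e) (hnn d)
  refine le_trans (le_of_eq ?_) key
  simp only [dotProduct_sub, dotProduct_add, dotProduct_neg, dotProduct_smul, smul_eq_mul]

/-- The deviation of a vector from its mean. -/
noncomputable def deviation (u : Fin N → ℝ) (i : Fin N) : ℝ := u i - (∑ j, u j) / N

theorem sum_deviation (hN : 0 < N) (u : Fin N → ℝ) : ∑ i, deviation u i = 0 := by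
  have : (N : ℝ) ≠ 0 := by positivity
  simp only [deviation, Finset.sum_sub_distrib, Finset.sum_const, Finset.card_univ,
    Fintype.card_fin, nsmul_eq_mul]
  field_simp
  ring

theorem sum_deviation_mul_deviation (hN : 0 < N) (u y : Fin N → ℝ) :
    ∑ i, deviation u i * deviation y i = deviation u ⬝ᵥ y := by
  have h1 : ∀ i, deviation u i * deviation y i =
      deviation u i * y i - deviation u i * ((∑ j, y j) / N) := by
    intro i
    rw [deviation.eq_def y]
    ring
  rw [Finset.sum_congr rfl fun i _ => h1 i, Finset.sum_sub_distrib, ← Finset.sum_mul,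
    sum_deviation hN, zero_mul, sub_zero, dotProduct]

theorem laplacian_mulVec_deviation (G : WeightedDigraph N) (u : Fin N → ℝ) :
    G.laplacian *ᵥ deviation u = G.laplacian *ᵥ u :=
  G.laplacian_mulVec_sub_const u _

/-- The second group of coordinates of the error system: the deviation from the mean of
`v - w + α (z - y)`, where `(y, w)` is an equilibrium. -/
noncomputable def auxState (α y : ℝ) (w z v : Fin N → ℝ) : Fin N → ℝ :=
  deviation fun i => v i - w i + α * (z i - y)

/-- The Lyapunov function of the error system. -/
noncomputable def lyapunov (α y : ℝ) (w z v : Fin N → ℝ) : ℝ :=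
  (α ^ 3 * ∑ i, (z i - y) ^ 2 + ∑ i, auxState α y w z v i ^ 2) / 2

theorem lyapunov_nonneg (hα : 0 ≤ α) (y : ℝ) (w z v : Fin N → ℝ) : 0 ≤ lyapunov α y w z v := by
  have h1 : 0 ≤ ∑ i, (z i - y) ^ 2 := Finset.sum_nonneg fun i _ => sq_nonneg _
  have h2 : 0 ≤ ∑ i, auxState α y w z v i ^ 2 := Finset.sum_nonneg fun i _ => sq_nonneg _
  unfold lyapunov
  positivity

theorem abs_sub_le_sqrt_lyapunov (hα : 1 ≤ α) (y : ℝ) (w z v : Fin N → ℝ) (i : Fin N) :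
    |z i - y| ≤ √(2 * lyapunov α y w z v) := by
  apply Real.abs_le_sqrt
  have h1 : (z i - y) ^ 2 ≤ ∑ i, (z i - y) ^ 2 :=
    Finset.single_le_sum (f := fun i => (z i - y) ^ 2) (fun i _ => sq_nonneg _)
      (Finset.mem_univ i)
  have h2 : 0 ≤ ∑ i, auxState α y w z v i ^ 2 := Finset.sum_nonneg fun i _ => sq_nonneg _
  have h3 : 1 ≤ α ^ 3 := one_le_pow₀ hα
  have h4 : 0 ≤ ∑ i, (z i - y) ^ 2 := Finset.sum_nonneg fun i _ => sq_nonneg _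
  unfold lyapunov
  nlinarith

theorem abs_auxState_le_sqrt_lyapunov (hα : 0 ≤ α) (y : ℝ) (w z v : Fin N → ℝ) (i : Fin N) :
    |auxState α y w z v i| ≤ √(2 * lyapunov α y w z v) := by
  apply Real.abs_le_sqrt
  have h1 : auxState α y w z v i ^ 2 ≤ ∑ i, auxState α y w z v i ^ 2 :=
    Finset.single_le_sum (f := fun i => auxState α y w z v i ^ 2) (fun i _ => sq_nonneg _)
      (Finset.mem_univ i)
  have h2 : 0 ≤ α ^ 3 * ∑ i, (z i - y) ^ 2 :=
    mul_nonneg (by positivity) (Finset.sum_nonneg fun i _ => sq_nonneg _)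
  unfold lyapunov
  linarith

/-- The derivative of `auxState` is again a deviation from the mean, but paired with `auxState`,
which has zero sum, the subtracted mean drops out. -/
theorem hasDerivWithinAt_lyapunov (hN : 0 < N) (y : ℝ) (w : Fin N → ℝ)
    {z v : Fin N → ℝ → ℝ} {z' v' : Fin N → ℝ} {S : Set ℝ} {s : ℝ}
    (hz : ∀ i, HasDerivWithinAt (z i) (z' i) S s) (hv : ∀ i, HasDerivWithinAt (v i) (v' i) S s) :
    HasDerivWithinAt (fun t => lyapunov α y w (fun i => z i t) (fun i => v i t))
      (α ^ 3 * ((fun i => z i s - y) ⬝ᵥ z') +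
        auxState α y w (fun i => z i s) (fun i => v i s) ⬝ᵥ (v' + α • z')) S s := by
  have hξ : ∀ i, HasDerivWithinAt (fun t => v i t - w i + α * (z i t - y)) ((v' + α • z') i) S s :=
    fun i => ((hv i).sub_const _).add (((hz i).sub_const _).const_mul α)
  have hx : ∀ i, HasDerivWithinAt
      (fun t => auxState α y w (fun i => z i t) (fun i => v i t) i)
      (deviation (v' + α • z') i) S s := fun i =>
    (hξ i).sub ((HasDerivWithinAt.fun_sum fun j _ => hξ j).div_const _)
  have h1 := ((HasDerivWithinAt.fun_sum fun i (_ : i ∈ Finset.univ) =>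
    ((hz i).sub_const y).fun_pow 2).const_mul (α ^ 3)).add
    (HasDerivWithinAt.fun_sum fun i (_ : i ∈ Finset.univ) => (hx i).fun_pow 2)
  refine (h1.div_const 2).congr_deriv ?_
  rw [auxState, ← sum_deviation_mul_deviation hN]
  simp only [dotProduct, Nat.cast_ofNat, Nat.add_one_sub_one, pow_one]
  rw [add_div, mul_div_assoc, Finset.sum_div, Finset.sum_div]
  congr 1
  · congr 1
    exact Finset.sum_congr rfl fun i _ => by ring
  · exact Finset.sum_congr rfl fun i _ => by ring

theorem WeightedDigraph.abs_laplacian_mulVec_le (G : WeightedDigraph N) {y : Fin N → ℝ} {R : ℝ}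
    (hy : ∀ i, |y i| ≤ R) (i : Fin N) :
    |(G.laplacian *ᵥ y) i| ≤ (∑ i, ∑ j, G.adj i j) * (2 * R) := by
  rw [G.laplacian_mulVec_apply]
  have hR : 0 ≤ R := (abs_nonneg _).trans (hy i)
  calc |∑ j, G.adj i j * (y i - y j)| ≤ ∑ j, |G.adj i j * (y i - y j)| :=
        Finset.abs_sum_le_sum_abs _ _
    _ ≤ ∑ j, G.adj i j * (2 * R) := by
        refine Finset.sum_le_sum fun j _ => ?_
        rw [abs_mul, abs_of_nonneg (G.adj_nonneg i j)]
        refine mul_le_mul_of_nonneg_left ?_ (G.adj_nonneg i j)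
        have := abs_sub (y i) (y j)
        linarith [hy i, hy j]
    _ = (∑ j, G.adj i j) * (2 * R) := by rw [Finset.sum_mul]
    _ ≤ _ := by
        refine mul_le_mul_of_nonneg_right ?_ (by positivity)
        exact Finset.single_le_sum (f := fun i => ∑ j, G.adj i j)
          (fun i _ => Finset.sum_nonneg fun j _ => G.adj_nonneg i j) (Finset.mem_univ i)

/-! ### Trajectories in error coordinates -/

namespace IsTrajectory

variable {f : Fin N → ℝ → ℝ} {c₀ c₁ γ : ℝ} {T : EReal} {z v zs vs : Fin N → ℝ → ℝ}

theorem sq_error_le (ht : IsTrajectory G f α β c₀ c₁ γ T z v zs vs) (hc₀ : 0 ≤ c₀)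
    (hc₁ : 0 ≤ c₁) (i : Fin N) {s : ℝ} (hs : 0 ≤ s) (hsT : (s : EReal) < T) :
    (zs i s - z i s) ^ 2 + (vs i s - v i s) ^ 2 ≤ (c₀ + c₁ * Real.exp (-γ * s)) ^ 2 := by
  obtain ⟨k, h1, h2, h3, h4⟩ := ht.sampled i s hs hsT
  have h5 := sqrt_error_le_of_lt_eventTime_succ hc₀ hc₁ hsT h1 h2
  have h6 := (Real.sqrt_le_left (by positivity)).1 h5
  rw [h3, h4]
  linarith

/-- The right-hand side of the generator in the coordinates of the error system. -/
theorem deriv_z_eq {y : ℝ} {w : Fin N → ℝ}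
    (hw : G.laplacian *ᵥ w = -(α • fun i => deriv (f i) y)) (s : ℝ) :
    (fun i => -α * deriv (f i) (z i s) - β * ∑ j, G.adj i j * (zs i s - zs j s)
        - ∑ j, G.adj i j * (vs i s - vs j s)) =
      -(α • fun i => deriv (f i) (z i s) - deriv (f i) y)
        - (β - α) • G.laplacian *ᵥ (fun i => z i s - y)
        - G.laplacian *ᵥ auxState α y w (fun i => z i s) (fun i => v i s)
        - β • G.laplacian *ᵥ (fun i => zs i s - z i s)
        - G.laplacian *ᵥ (fun i => vs i s - v i s) := by
  have h1 : (fun i => z i s - y) + (fun i => zs i s - z i s) = fun i => zs i s - y := by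
    ext i; simp
  have h2 : G.laplacian *ᵥ (fun i => z i s - y) + G.laplacian *ᵥ (fun i => zs i s - z i s) =
      G.laplacian *ᵥ (fun i => zs i s) := by
    rw [← mulVec_add, h1, G.laplacian_mulVec_sub_const]
  -- The sampled `v` is written through the sampling error, the undeviated auxiliary state and `w`.
  -- Under `L` the mean disappears, and `L w` supplies the `-α f'(y)` that centres the gradient.
  have h3 : (fun i => vs i s - v i s) + (fun i => v i s - w i + α * (z i s - y)) + w
      - α • (fun i => z i s - y) = fun i => vs i s := by
    ext i; simp; ring
  have h4 : G.laplacian *ᵥ (fun i => vs i s - v i s)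
      + G.laplacian *ᵥ auxState α y w (fun i => z i s) (fun i => v i s)
      - (α • fun i => deriv (f i) y) - α • G.laplacian *ᵥ (fun i => z i s - y) =
      G.laplacian *ᵥ (fun i => vs i s) := by
    rw [auxState, laplacian_mulVec_deviation, ← h3, mulVec_sub, mulVec_add, mulVec_add, hw,
      mulVec_smul]
    abel
  ext i
  have h5 := congrFun h2 i
  have h6 := congrFun h4 i
  simp only [Pi.add_apply, Pi.sub_apply, Pi.smul_apply, Pi.neg_apply, smul_eq_mul,
    G.laplacian_mulVec_apply (fun i => zs i s), G.laplacian_mulVec_apply (fun i => vs i s)]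
    at h5 h6 ⊢
  rw [← h5, ← h6]
  ring

theorem deriv_v_eq (y : ℝ) (s : ℝ) :
    (fun i => α * β * ∑ j, G.adj i j * (zs i s - zs j s)) =
      (α * β) • (G.laplacian *ᵥ (fun i => z i s - y)
        + G.laplacian *ᵥ (fun i => zs i s - z i s)) := by
  have h1 : (fun i => z i s - y) + (fun i => zs i s - z i s) = fun i => zs i s - y := by
    ext i; simp
  rw [← mulVec_add, h1, G.laplacian_mulVec_sub_const]
  ext i
  simp [G.laplacian_mulVec_apply]

/-- Dissipation and the triggering rule feed Gronwall. The bound `(c₀ + c₁ E)² ≤ 2 c₀² + 2 c₁² E²`,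
summed over the `N` agents, separates the persistent part from the decaying one, so that `c₁`
affects only the transient. -/
theorem lyapunov_le (ht : IsTrajectory G f α β c₀ c₁ γ T z v zs vs)
    (hg : AdmissibleGains G α β η m h l Λ) (hN : 0 < N)
    (hF : ∀ i a b, m * (a - b) ^ 2 ≤ (a - b) * (deriv (f i) a - deriv (f i) b))
    (hF' : ∀ i a b, |deriv (f i) a - deriv (f i) b| ≤ h * |a - b|)
    {y : ℝ} {w : Fin N → ℝ} (hw : G.laplacian *ᵥ w = -(α • fun i => deriv (f i) y))
    (hc₀ : 0 ≤ c₀) (hc₁ : 0 ≤ c₁) (hγ : 2 * γ < η) {s : ℝ} (hs : 0 ≤ s) (hsT : (s : EReal) < T) :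
    lyapunov α y w (fun i => z i s) (fun i => v i s) ≤
      lyapunov α y w (fun i => z i 0) (fun i => v i 0) * Real.exp (-η * s)
        + perturbationGain α β η Λ * (2 * N * c₀ ^ 2) / η
        + perturbationGain α β η Λ * (2 * N * c₁ ^ 2) / (η - 2 * γ) * Real.exp (-γ * s) ^ 2 := by
  have hK := hg.perturbationGain_pos
  have hsub : ∀ t ∈ Set.Icc 0 s, 0 ≤ t ∧ (t : EReal) < T := fun t ht =>
    ⟨ht.1, lt_of_le_of_lt (EReal.coe_le_coe_iff.2 ht.2) hsT⟩
  have hzc : ∀ i, ContinuousOn (z i) (Set.Icc 0 s) := fun i =>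
    (ht.continuousOn_z i).mono hsub
  have hvc : ∀ i, ContinuousOn (v i) (Set.Icc 0 s) := fun i =>
    (ht.continuousOn_v i).mono hsub
  refine le_of_hasDerivWithinAt_le_neg_mul_add
    (V := fun t => lyapunov α y w (fun i => z i t) (fun i => v i t)) hg.eta_pos hγ
    (by positivity) (by positivity) hs ?_
    (fun t htm => hasDerivWithinAt_lyapunov hN y w
      (fun i => ht.deriv_z i t (hsub t (Set.Ico_subset_Icc_self htm)).1
        (hsub t (Set.Ico_subset_Icc_self htm)).2)
      (fun i => ht.deriv_v i t (hsub t (Set.Ico_subset_Icc_self htm)).1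
        (hsub t (Set.Ico_subset_Icc_self htm)).2)) ?_
  · unfold lyapunov auxState deviation
    fun_prop
  · intro t htm
    obtain ⟨ht0, htT⟩ := hsub t (Set.Ico_subset_Icc_self htm)
    rw [deriv_z_eq (v := v) hw t, deriv_v_eq (z := z) y t]
    have h1 := hg.dissipation (z := fun i => z i t - y)
      (x := auxState α y w (fun i => z i t) (fun i => v i t))
      (e := fun i => zs i t - z i t) (d := fun i => vs i t - v i t)
      (F := fun i => deriv (f i) (z i t) - deriv (f i) y) (sum_deviation hN _)
      (fun i => hF i _ _) (fun i => hF' i _ _)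
    have h2 : ∑ i, (zs i t - z i t) ^ 2 + ∑ i, (vs i t - v i t) ^ 2 ≤
        2 * N * c₀ ^ 2 + 2 * N * c₁ ^ 2 * Real.exp (-γ * t) ^ 2 := by
      rw [← Finset.sum_add_distrib]
      calc _ ≤ ∑ i : Fin N, (2 * c₀ ^ 2 + 2 * c₁ ^ 2 * Real.exp (-γ * t) ^ 2) := by
            refine Finset.sum_le_sum fun i _ => (ht.sq_error_le hc₀ hc₁ i ht0 htT).trans ?_
            nlinarith [sq_nonneg (c₀ - c₁ * Real.exp (-γ * t))]
        _ = _ := by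
            rw [Finset.sum_const, Finset.card_univ, Fintype.card_fin, nsmul_eq_mul]
            ring
    have h3 := mul_le_mul_of_nonneg_left h2 hK.le
    refine le_trans (le_of_eq ?_) (h1.trans ?_)
    · congr 2
      ext i
      simp only [Pi.add_apply, Pi.sub_apply, Pi.smul_apply, Pi.neg_apply, smul_eq_mul]
      ring
    · unfold lyapunov
      linarith

end IsTrajectory

end EventGenerator

/-! ### Speed bounds and comparison with the threshold -/

namespace EventGenerator

open Matrix

variable {N : ℕ} {G : WeightedDigraph N} {α β η m h l Λ : ℝ}

/-- A bound for the speed of the generator in terms of the size of the error system. -/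
noncomputable def speedGain (G : WeightedDigraph N) (α β h : ℝ) : ℝ :=
  α * h + (∑ i, ∑ j, G.adj i j) * (2 * |β - α| + 2 * |β| + 4 + 4 * |α * β|) + 1

theorem speedGain_pos (hα : 0 ≤ α) (hh : 0 ≤ h) : 0 < speedGain G α β h := by
  have : 0 ≤ ∑ i, ∑ j, G.adj i j :=
    Finset.sum_nonneg fun i _ => Finset.sum_nonneg fun j _ => G.adj_nonneg i j
  unfold speedGain
  positivity

theorem abs_speed_z_le (hα : 0 ≤ α) {z x e d F : Fin N → ℝ} {R : ℝ}
    (hh : 0 ≤ h) (hF : ∀ i, |F i| ≤ h * |z i|) (hz : ∀ i, |z i| ≤ R) (hx : ∀ i, |x i| ≤ R)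
    (he : ∀ i, |e i| ≤ R) (hd : ∀ i, |d i| ≤ R) (i : Fin N) :
    |(-(α • F) - (β - α) • G.laplacian *ᵥ z - G.laplacian *ᵥ x
        - β • G.laplacian *ᵥ e - G.laplacian *ᵥ d) i| ≤ speedGain G α β h * R := by
  have hR : 0 ≤ R := (abs_nonneg _).trans (hz i)
  have hS : 0 ≤ ∑ i, ∑ j, G.adj i j :=
    Finset.sum_nonneg fun i _ => Finset.sum_nonneg fun j _ => G.adj_nonneg i j
  have h1 : |α * F i| ≤ α * (h * R) := by
    rw [abs_mul, abs_of_nonneg hα]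
    have := (hF i).trans (mul_le_mul_of_nonneg_left (hz i) hh)
    gcongr
  have h2 : |(β - α) * (G.laplacian *ᵥ z) i| ≤ |β - α| * ((∑ i, ∑ j, G.adj i j) * (2 * R)) := by
    rw [abs_mul]
    gcongr
    exact G.abs_laplacian_mulVec_le hz i
  have h3 := G.abs_laplacian_mulVec_le hx i
  have h4 : |β * (G.laplacian *ᵥ e) i| ≤ |β| * ((∑ i, ∑ j, G.adj i j) * (2 * R)) := by
    rw [abs_mul]
    gcongr
    exact G.abs_laplacian_mulVec_le he i
  have h5 := G.abs_laplacian_mulVec_le hd i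
  have h6 : 0 ≤ (∑ i, ∑ j, G.adj i j) * |α * β| * R := by positivity
  simp only [Pi.sub_apply, Pi.smul_apply, Pi.neg_apply, smul_eq_mul]
  rw [abs_le] at h1 h2 h3 h4 h5 ⊢
  unfold speedGain
  constructor <;> linarith [h1.1, h1.2, h2.1, h2.2, h3.1, h3.2, h4.1, h4.2, h5.1, h5.2]

theorem abs_speed_v_le (hα : 0 ≤ α) (hh : 0 ≤ h) {z e : Fin N → ℝ} {R : ℝ}
    (hz : ∀ i, |z i| ≤ R) (he : ∀ i, |e i| ≤ R) (i : Fin N) :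
    |((α * β) • (G.laplacian *ᵥ z + G.laplacian *ᵥ e)) i| ≤ speedGain G α β h * R := by
  have hR : 0 ≤ R := (abs_nonneg _).trans (hz i)
  have hS : 0 ≤ ∑ i, ∑ j, G.adj i j :=
    Finset.sum_nonneg fun i _ => Finset.sum_nonneg fun j _ => G.adj_nonneg i j
  simp only [Pi.add_apply, Pi.smul_apply, smul_eq_mul]
  calc |α * β * ((G.laplacian *ᵥ z) i + (G.laplacian *ᵥ e) i)|
      ≤ |α * β| * ((∑ i, ∑ j, G.adj i j) * (2 * R) + (∑ i, ∑ j, G.adj i j) * (2 * R)) := by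
        rw [abs_mul]
        gcongr
        exact (abs_add_le _ _).trans
          (add_le_add (G.abs_laplacian_mulVec_le hz i) (G.abs_laplacian_mulVec_le he i))
    _ = ((∑ i, ∑ j, G.adj i j) * (4 * |α * β|)) * R := by ring
    _ ≤ _ := by
        unfold speedGain
        gcongr
        have h1 : 0 ≤ α * h := by positivity
        have h2 : 0 ≤ (∑ i, ∑ j, G.adj i j) * (2 * |β - α| + 2 * |β| + 4) := by positivity
        linarith

/-- Since `2 γ < η`, the initial energy decays at least as fast as `exp (-γ s) ^ 2`; then `√(a² +
b²) ≤ a + b` splits off the part proportional to `c₀`. -/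
theorem sqrt_two_mul_lyapunov_le {V V₀ K c₀ c₁ γ s : ℝ} (hη : 0 < η) (hV₀ : 0 ≤ V₀)
    (hK : 0 ≤ K) (hγ : 2 * γ < η) (hc₀ : 0 ≤ c₀) (hs : 0 ≤ s)
    (hV : V ≤ V₀ * Real.exp (-η * s) + K * (2 * N * c₀ ^ 2) / η
        + K * (2 * N * c₁ ^ 2) / (η - 2 * γ) * Real.exp (-γ * s) ^ 2) :
    √(2 * V) ≤ √(4 * K * N / η) * c₀ +
      √(2 * V₀ + 4 * K * N * c₁ ^ 2 / (η - 2 * γ)) * Real.exp (-γ * s) := by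
  have hδ : 0 < η - 2 * γ := by linarith
  have h1 : Real.exp (-η * s) ≤ Real.exp (-γ * s) ^ 2 := by
    rw [← Real.exp_nat_mul]
    apply Real.exp_le_exp.2
    push_cast
    nlinarith
  have ha : 0 ≤ 4 * K * N / η := by positivity
  have hb : 0 ≤ 2 * V₀ + 4 * K * N * c₁ ^ 2 / (η - 2 * γ) := by positivity
  have h2 : V₀ * Real.exp (-η * s) ≤ V₀ * Real.exp (-γ * s) ^ 2 := by gcongr
  refine Real.sqrt_le_iff.2 ⟨by positivity, ?_⟩
  have h3 : 0 ≤ (√(4 * K * N / η) * c₀) *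
      (√(2 * V₀ + 4 * K * N * c₁ ^ 2 / (η - 2 * γ)) * Real.exp (-γ * s)) := by positivity
  calc 2 * V ≤ 4 * K * N / η * c₀ ^ 2 +
        (2 * V₀ + 4 * K * N * c₁ ^ 2 / (η - 2 * γ)) * Real.exp (-γ * s) ^ 2 := by
        refine (mul_le_mul_of_nonneg_left hV zero_le_two).trans ?_
        have e1 : 2 * (K * (2 * N * c₀ ^ 2) / η) = 4 * K * N / η * c₀ ^ 2 := by ring
        have e2 : 2 * (K * (2 * N * c₁ ^ 2) / (η - 2 * γ) * Real.exp (-γ * s) ^ 2) =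
          4 * K * N * c₁ ^ 2 / (η - 2 * γ) * Real.exp (-γ * s) ^ 2 := by ring
        linarith
    _ = (√(4 * K * N / η) * c₀) ^ 2 +
        (√(2 * V₀ + 4 * K * N * c₁ ^ 2 / (η - 2 * γ)) * Real.exp (-γ * s)) ^ 2 := by
        rw [mul_pow, mul_pow, Real.sq_sqrt ha, Real.sq_sqrt hb]
    _ ≤ _ := by linarith

/-- Turns the state bound into a multiple of the threshold, uniformly in time. As `E ≤ 1`, one has
`(c₀ + c₁) E ≤ c₀ + c₁ E`, so `c₀` or `c₁` alone may vanish. -/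
theorem add_le_mul_threshold {κ C c₀ c₁ E : ℝ} (hκ : 0 ≤ κ) (hC : 0 ≤ C) (hc₀ : 0 ≤ c₀)
    (hc₁ : 0 ≤ c₁) (hc : 0 < c₀ + c₁) (hE : 0 ≤ E) (hE1 : E ≤ 1) :
    κ * c₀ + C * E + (c₀ + c₁ * E) ≤ (κ + C / (c₀ + c₁) + 1) * (c₀ + c₁ * E) := by
  have h1 : C * E ≤ C / (c₀ + c₁) * (c₀ + c₁ * E) := by
    rw [div_mul_eq_mul_div, le_div_iff₀ hc]
    have : C * (c₀ * E) ≤ C * c₀ := by gcongr; nlinarith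
    linarith
  have h2 : 0 ≤ κ * (c₁ * E) := by positivity
  linarith

/-- A function with derivative in `[m, h]` is strongly monotone and Lipschitz. -/
theorem mul_sub_le_sub_and_sub_le_mul_sub {g : ℝ → ℝ} (hg : Differentiable ℝ g)
    (hd : ∀ s, m ≤ deriv g s ∧ deriv g s ≤ h) {a b : ℝ} (hab : a ≤ b) :
    m * (b - a) ≤ g b - g a ∧ g b - g a ≤ h * (b - a) :=
  ⟨mul_sub_le_image_sub_of_le_deriv hg (fun s => (hd s).1) hab,
    image_sub_le_mul_sub_of_deriv_le hg (fun s => (hd s).2) hab⟩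

theorem mul_sq_le_sub_mul_sub {g : ℝ → ℝ} (hg : Differentiable ℝ g)
    (hd : ∀ s, m ≤ deriv g s ∧ deriv g s ≤ h) (a b : ℝ) :
    m * (a - b) ^ 2 ≤ (a - b) * (g a - g b) := by
  rcases le_total a b with hab | hab
  · have := (mul_sub_le_sub_and_sub_le_mul_sub hg hd hab).1
    nlinarith
  · have := (mul_sub_le_sub_and_sub_le_mul_sub hg hd hab).1
    nlinarith

theorem abs_sub_le_mul_abs_sub {g : ℝ → ℝ} (hm : 0 ≤ m) (hg : Differentiable ℝ g)
    (hd : ∀ s, m ≤ deriv g s ∧ deriv g s ≤ h) (a b : ℝ) :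
    |g a - g b| ≤ h * |a - b| := by
  wlog hab : b ≤ a generalizing a b
  · rw [abs_sub_comm, abs_sub_comm a]
    exact this b a (le_of_not_ge hab)
  obtain ⟨h1, h2⟩ := mul_sub_le_sub_and_sub_le_mul_sub hg hd hab
  rw [abs_of_nonneg (sub_nonneg.2 hab), abs_of_nonneg]
  · exact h2
  · exact (mul_nonneg hm (sub_nonneg.2 hab)).trans h1

/-- Speed of the states along a trajectory. -/
theorem IsTrajectory.abs_deriv_le {f : Fin N → ℝ → ℝ} {c₀ c₁ γ : ℝ} {T : EReal}
    {z v zs vs : Fin N → ℝ → ℝ} (ht : IsTrajectory G f α β c₀ c₁ γ T z v zs vs)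
    (hα : 1 ≤ α) (hh : 0 ≤ h) (hF : ∀ i a b, |deriv (f i) a - deriv (f i) b| ≤ h * |a - b|)
    {y : ℝ} {w : Fin N → ℝ} (hw : G.laplacian *ᵥ w = -(α • fun i => deriv (f i) y))
    (hc₀ : 0 ≤ c₀) (hc₁ : 0 ≤ c₁) {s : ℝ} (hs : 0 ≤ s) (hsT : (s : EReal) < T) (i : Fin N) :
    |-α * deriv (f i) (z i s) - β * ∑ j, G.adj i j * (zs i s - zs j s)
        - ∑ j, G.adj i j * (vs i s - vs j s)| ≤ speedGain G α β h *
          (√(2 * lyapunov α y w (fun i => z i s) (fun i => v i s)) +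
            (c₀ + c₁ * Real.exp (-γ * s))) ∧
    |α * β * ∑ j, G.adj i j * (zs i s - zs j s)| ≤ speedGain G α β h *
          (√(2 * lyapunov α y w (fun i => z i s) (fun i => v i s)) +
            (c₀ + c₁ * Real.exp (-γ * s))) := by
  have hα0 : 0 ≤ α := by linarith
  have hthr : 0 ≤ c₀ + c₁ * Real.exp (-γ * s) := by positivity
  have hsqrt := Real.sqrt_nonneg (2 * lyapunov α y w (fun i => z i s) (fun i => v i s))
  have hz : ∀ i, |z i s - y| ≤ √(2 * lyapunov α y w (fun i => z i s) (fun i => v i s)) +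
      (c₀ + c₁ * Real.exp (-γ * s)) := fun i => by
    have := abs_sub_le_sqrt_lyapunov hα y w (fun i => z i s) (fun i => v i s) i
    linarith
  have hx : ∀ i, |auxState α y w (fun i => z i s) (fun i => v i s) i| ≤
      √(2 * lyapunov α y w (fun i => z i s) (fun i => v i s)) +
        (c₀ + c₁ * Real.exp (-γ * s)) := fun i => by
    have := abs_auxState_le_sqrt_lyapunov hα0 y w (fun i => z i s) (fun i => v i s) i
    linarith
  have he : ∀ i, |zs i s - z i s| ≤
      √(2 * lyapunov α y w (fun i => z i s) (fun i => v i s)) +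
        (c₀ + c₁ * Real.exp (-γ * s)) := fun i => by
    have h1 := ht.sq_error_le hc₀ hc₁ i hs hsT
    have := abs_le_of_sq_le_sq (by linarith [sq_nonneg (vs i s - v i s)] :
      (zs i s - z i s) ^ 2 ≤ _) hthr
    linarith
  have hd : ∀ i, |vs i s - v i s| ≤
      √(2 * lyapunov α y w (fun i => z i s) (fun i => v i s)) +
        (c₀ + c₁ * Real.exp (-γ * s)) := fun i => by
    have h1 := ht.sq_error_le hc₀ hc₁ i hs hsT
    have := abs_le_of_sq_le_sq (by linarith [sq_nonneg (zs i s - z i s)] :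
      (vs i s - v i s) ^ 2 ≤ _) hthr
    linarith
  have h1 := abs_speed_z_le (G := G) (β := β) hα0 hh
    (F := fun i => deriv (f i) (z i s) - deriv (f i) y) (fun i => hF i _ _) hz hx he hd i
  have h2 := abs_speed_v_le (G := G) (β := β) hα0 hh hz he i
  rw [← deriv_z_eq (v := v) (zs := zs) (vs := vs) hw s] at h1
  rw [← deriv_v_eq (z := z) (zs := zs) y s] at h2
  exact ⟨h1, h2⟩

end EventGenerator

/-! ### Choice of constants and conclusion -/

theorem lemma2 {N : ℕ} (hN : 2 ≤ N) (G : EventGenerator.WeightedDigraph N)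
    (hconn : G.StronglyConnected) (hbal : G.WeightBalanced)
    (f : Fin N → ℝ → ℝ) (hf : ∀ i, ContDiff ℝ 2 (f i))
    (hlo hup : Fin N → ℝ) (hlo_pos : ∀ i, 0 < hlo i)
    (hhess : ∀ i s, hlo i ≤ deriv (deriv (f i)) s ∧ deriv (deriv (f i)) s ≤ hup i)
    (ystar : ℝ) (hystar : IsMinOn (fun s => ∑ i, f i s) Set.univ ystar)
    (η α β : ℝ) (hη : 0 < η)
    (hα : max 1 (max (2 * η / min (⨅ i, hlo i) (G.lambdaTwo hN))
      (6 * (⨆ i, hup i) ^ 2 / ((⨅ i, hlo i) * G.lambdaTwo hN))) ≤ α)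
    (hβ : max 1 (7 * α ^ 2 * G.lambdaMax hN ^ 2 / G.lambdaTwo hN ^ 2) ≤ β) :
    -- the factor of proportionality does not depend on the triggering rule or the trajectory
    ∃ κ : ℝ, 0 < κ ∧
      ∀ c₀ c₁ γ : ℝ, 0 ≤ c₀ → 0 ≤ c₁ → 0 < c₀ + c₁ → 0 < γ → γ < min 1 (η / 2) →
        -- exponential rate
        ∃ μ : ℝ, 0 < μ ∧
          -- initial values
          ∀ z₀ v₀ : Fin N → ℝ,
            ∃ τ C : ℝ, 0 < τ ∧ 0 < C ∧
              ∀ (T : EReal) (z v zs vs : Fin N → ℝ → ℝ),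
                EventGenerator.IsTrajectory G f α β c₀ c₁ γ T z v zs vs →
                (∀ i, z i 0 = z₀ i) → (∀ i, v i 0 = v₀ i) →
                -- the inter-event times are larger than `τ`
                (∀ i k, EventGenerator.eventTime c₀ c₁ γ T (z i) (v i) k ≠ ⊤ →
                  EventGenerator.eventTime c₀ c₁ γ T (z i) (v i) k + (τ : EReal) <
                    EventGenerator.eventTime c₀ c₁ γ T (z i) (v i) (k + 1)) ∧
                -- exponential convergence into `[ystar - κ c₀, ystar + κ c₀]`
                (∀ i, ∀ s : ℝ, 0 ≤ s → (s : EReal) < T →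
                  |z i s - ystar| ≤ κ * c₀ + C * Real.exp (-μ * s)) := by
  have hN0 : 0 < N := by omega
  have : Nonempty (Fin N) := ⟨⟨0, hN0⟩⟩
  have hl := hbal.lambdaTwo_pos hconn hN
  have hm : 0 < ⨅ i, hlo i := by
    obtain ⟨i, hi⟩ := exists_eq_ciInf_of_finite (f := hlo)
    rw [← hi]
    exact hlo_pos i
  have hmi : ∀ i, ⨅ i, hlo i ≤ hlo i := fun i => ciInf_le (Set.finite_range hlo).bddBelow i
  have hhi : ∀ i, hup i ≤ ⨆ i, hup i := fun i => le_ciSup (Set.finite_range hup).bddAbove i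
  have hd : ∀ i s, ⨅ i, hlo i ≤ deriv (deriv (f i)) s ∧ deriv (deriv (f i)) s ≤ ⨆ i, hup i :=
    fun i s => ⟨(hmi i).trans (hhess i s).1, (hhess i s).2.trans (hhi i)⟩
  have hh : 0 ≤ ⨆ i, hup i := by
    have := hd ⟨0, hN0⟩ 0
    linarith
  have hfd : ∀ i, Differentiable ℝ (f i) := fun i => (hf i).differentiable (by norm_num)
  have hdiff : ∀ i, Differentiable ℝ (deriv (f i)) := fun i =>
    ((contDiff_succ_iff_deriv (n := 1)).1 (hf i)).2.2.differentiable (by norm_num)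
  have hα1 : 1 ≤ α := (le_max_left _ _).trans hα
  have hα2 : 2 * η / min (⨅ i, hlo i) (G.lambdaTwo hN) ≤ α :=
    ((le_max_left _ _).trans (le_max_right _ _)).trans hα
  have hα3 : 6 * (⨆ i, hup i) ^ 2 / ((⨅ i, hlo i) * G.lambdaTwo hN) ≤ α :=
    ((le_max_right _ _).trans (le_max_right _ _)).trans hα
  have hβ2 := (le_max_right _ _).trans hβ
  have hα0 : 0 ≤ α := by linarith
  rw [div_le_iff₀ (lt_min hm hl)] at hα2
  rw [div_le_iff₀ (mul_pos hm hl)] at hα3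
  rw [div_le_iff₀ (by positivity)] at hβ2
  have hg : EventGenerator.AdmissibleGains G α β η (⨅ i, hlo i) (⨆ i, hup i) (G.lambdaTwo hN)
      (G.lambdaMax hN) :=
    { balanced := hbal
      eta_pos := hη
      one_le_alpha := hα1
      lower_pos := hm
      upper_nonneg := hh
      gap_pos := hl
      gap_le := G.lambdaTwo_le_lambdaMax hN
      two_eta_le_lower := hα2.trans (mul_le_mul_of_nonneg_left (min_le_left _ _) hα0)
      two_eta_le_gap := hα2.trans (mul_le_mul_of_nonneg_left (min_le_right _ _) hα0)
      six_le := hα3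
      seven_le := hβ2
      diagonal_le := G.laplacian_apply_self_le_lambdaMax hN
      gap_mul_le := fun x hx => hbal.lambdaTwo_mul_le hconn hN hx }
  have hF := fun i => EventGenerator.mul_sq_le_sub_mul_sub (hdiff i) (hd i)
  have hF' := fun i => EventGenerator.abs_sub_le_mul_abs_sub hm.le (hdiff i) (hd i)
  have hsum : ∑ i, deriv (f i) ystar = 0 := by
    have h1 : HasDerivAt (fun s => ∑ i, f i s) (∑ i, deriv (f i) ystar) ystar :=
      HasDerivAt.fun_sum fun i _ => (hfd i ystar).hasDerivAt
    exact (hystar.isLocalMin Filter.univ_mem).hasDerivAt_eq_zero h1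
  -- The `v`-component of an equilibrium; solvability is exactly the first-order condition `hsum` at
  -- the minimizer.
  obtain ⟨w, hw⟩ := hbal.exists_laplacian_mulVec_eq hconn hN0
    (y := -(α • fun i => deriv (f i) ystar)) (by
      simp only [Pi.neg_apply, Pi.smul_apply, smul_eq_mul]
      rw [Finset.sum_neg_distrib, ← Finset.mul_sum, hsum, mul_zero, neg_zero])
  have hK := hg.perturbationGain_pos
  set K := EventGenerator.perturbationGain α β η (G.lambdaMax hN)
  -- This is the limit of `√(2V) / c₀` allowed by Gronwall; `K` involves only `α`, `β`, `η` and
  -- `λ_N`.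
  refine ⟨√(4 * K * N / η), by positivity, ?_⟩
  intro c₀ c₁ γ hc₀ hc₁ hc hγ hγlt
  have hγ1 : γ < 1 := hγlt.trans_le (min_le_left _ _)
  have hγη : 2 * γ < η := by linarith [hγlt.trans_le (min_le_right _ _)]
  have hδ : 0 < η - 2 * γ := by linarith
  refine ⟨γ, hγ, fun z₀ v₀ => ?_⟩
  have hV₀ := EventGenerator.lyapunov_nonneg hα0 ystar w z₀ v₀
  set κ := √(4 * K * N / η)
  set C := √(2 * EventGenerator.lyapunov α ystar w z₀ v₀ + 4 * K * N * c₁ ^ 2 / (η - 2 * γ))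
  have hP := EventGenerator.speedGain_pos (G := G) (β := β) hα0 hh
  set P := EventGenerator.speedGain G α β (⨆ i, hup i)
  have hD : 0 < P * (κ + C / (c₀ + c₁) + 1) := by positivity
  -- The first witness is the dwell time for the speed factor `D = P (κ + C / (c₀ + c₁) + 1)`. In
  -- the second, `1` is added because `C` may be zero: with `c₁ = 0` and a start at equilibrium.
  refine ⟨min 1 (1 / (8 * (P * (κ + C / (c₀ + c₁) + 1)))) / 2, C + 1, by positivity,
    by positivity, ?_⟩
  intro T z v zs vs ht hz₀ hv₀
  have hV : ∀ s : ℝ, 0 ≤ s → (s : EReal) < T →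
      √(2 * EventGenerator.lyapunov α ystar w (fun i => z i s) (fun i => v i s)) ≤
        κ * c₀ + C * Real.exp (-γ * s) := by
    intro s hs hsT
    have h1 := ht.lyapunov_le hg hN0 hF hF' hw hc₀ hc₁ hγη hs hsT
    simp only [hz₀, hv₀] at h1
    exact EventGenerator.sqrt_two_mul_lyapunov_le hη hV₀ hK.le hγη hc₀ hs h1
  have hrate : ∀ s : ℝ, 0 ≤ s → (s : EReal) < T →
      P * (√(2 * EventGenerator.lyapunov α ystar w (fun i => z i s) (fun i => v i s)) +
        (c₀ + c₁ * Real.exp (-γ * s))) ≤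
      P * (κ + C / (c₀ + c₁) + 1) * (c₀ + c₁ * Real.exp (-γ * s)) := by
    intro s hs hsT
    rw [mul_assoc]
    refine mul_le_mul_of_nonneg_left ?_ hP.le
    have h1 := EventGenerator.add_le_mul_threshold (κ := κ) (C := C) (E := Real.exp (-γ * s))
      (by positivity) (by positivity) hc₀ hc₁ hc (by positivity)
      (Real.exp_le_one_iff.2 (by nlinarith))
    linarith [hV s hs hsT]
  refine ⟨fun i k hk => ?_, fun i s hs hsT => ?_⟩
  · exact EventGenerator.eventTime_add_lt_eventTime_succ ht.horizon_pos hc₀ hc₁ hc hγ hγ1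
      (ht.continuousOn_z i) (ht.continuousOn_v i) hD (ht.deriv_z i) (ht.deriv_v i)
      (fun s hs hsT => (ht.abs_deriv_le hα1 hh hF' hw hc₀ hc₁ hs hsT i).1.trans (hrate s hs hsT))
      (fun s hs hsT => (ht.abs_deriv_le hα1 hh hF' hw hc₀ hc₁ hs hsT i).2.trans (hrate s hs hsT))
      k hk
  · have h1 := EventGenerator.abs_sub_le_sqrt_lyapunov hα1 ystar w (fun i => z i s)
      (fun i => v i s) i
    have h2 := hV s hs hsT
    have h3 := Real.exp_pos (-γ * s)
    linarith
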